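/- Let $L$ be the Lagrange spectrum, i.e. the set of all finite values of $\limsup_{p,q\to\infty,\ p,q\in\mathbb Z}\frac{1}{|q(q\alpha-p)|}$ with $\alpha\in\mathbb R\setminus\mathbb Q$ (here $p,q\to\infty$ means $|p|,|q|\to\infty$), and let $M$ be the Markov spectrum, i.e. the set of all finite values of $\Big(\inf_{(x,y)\in\mathbb Z^2\setminus\{(0,0)\}}|ax^2+bxy+cy^2|\Big)^{-1}$ with $a,b,c\in\mathbb R$, $b^2-4ac=1$. Let $$X_3(\{13,31\})=\{[0;\gamma_0,\gamma_1,\gamma_2,\dots] : \gamma_n\in\{1,2,3\}\text{ for all } n\ge 0,\ (\gamma_n,\gamma_{n+1})\notin\{(1,3),(3,1)\}\text{ for all } n\ge 0\},$$ where $[0;\gamma_0,\gamma_1,\dots]$ denotes the value of the infinite continued fraction $\cfrac{1}{\gamma_0+\cfrac{1}{\gamma_1+\cdots}}$. Then there is a set $K\subset\mathbb R$ of Hausdorff dimension $HD(K)<0.281266$ such that $$(M\setminus L)\cap(\sqrt{13},\,3.84)\subset X_3(\{13,31\})+K=\{x+y : x\in X_3(\{13,31\}),\ y\in K\}.$$ 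-/

import Mathlib

open Filter Topology
open scoped Pointwise

noncomputable section

/-- The Lagrange spectrum: the finite values of
`limsup 1 / |q (q α - p)|` as the integers `p`, `q` tend to infinity (in absolute value),
for `α` irrational.  The upper limit is taken in the extended reals, so that equality with (the
coercion of) a real number says in particular that it is finite. -/
def lagrangeSpectrum : Set ℝ :=
  {x | ∃ α : ℝ, Irrational α ∧
    limsup (fun z : ℤ × ℤ => ((1 / |(z.2 : ℝ) * ((z.2 : ℝ) * α - (z.1 : ℝ))| : ℝ) : EReal))
      (cofinite ×ˢ cofinite) = (x : EReal)}

/-- The infimum of `|a x² + b x y + c y²|` over the integer vectors `(x, y) ≠ (0, 0)`. -/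
def quadFormInf (a b c : ℝ) : ℝ :=
  ⨅ v : {v : ℤ × ℤ // v ≠ 0},
    |a * (v.1.1 : ℝ) ^ 2 + b * (v.1.1 : ℝ) * (v.1.2 : ℝ) + c * (v.1.2 : ℝ) ^ 2|

/-- The Markov spectrum: the finite values of `1 / inf |q(x, y)|`, where
`q(x, y) = a x² + b x y + c y²` runs over the real binary quadratic forms with `b² - 4ac = 1`
(these are indefinite).  Finiteness means that the infimum is positive. -/
def markovSpectrum : Set ℝ :=
  {m | ∃ a b c : ℝ, b ^ 2 - 4 * a * c = 1 ∧ 0 < quadFormInf a b c ∧ m = 1 / quadFormInf a b c}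

/-- The infinite continued fraction `[0; γ 0, γ 1, γ 2, …]`. -/
def contFracOf (γ : ℕ → ℕ) : GenContFract ℝ :=
  ⟨0, Stream'.Seq.ofStream (fun n => ⟨1, (γ n : ℝ)⟩)⟩

/-- The sequence `γ` contains the finite word `w` as a block of consecutive letters. -/
def ContainsWord (γ : ℕ → ℕ) (w : List ℕ) : Prop :=
  ∃ n : ℕ, ∀ i : Fin w.length, γ (n + i) = w.get i

/-- `X_k(F)`: the values `[0; γ]` of the infinite continued fractions with all digits in
`{1, …, k}` such that `γ` contains no word of `F`. -/
def XSet (k : ℕ) (F : Set (List ℕ)) : Set ℝ :=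
  {x | ∃ γ : ℕ → ℕ, (∀ n, γ n ∈ Set.Icc 1 k) ∧ (∀ w ∈ F, ¬ ContainsWord γ w) ∧
    Tendsto (fun n => (contFracOf γ).convs n) atTop (𝓝 x)}

end

open Filter Topology
open scoped Pointwise

noncomputable section

/-! The set K can be taken countable, hence of dimension 0. By reduction of indefinite forms, a
point m of M in (√13, 3.84) equals 3 + [0; a 1, …] + [0; b 1, …], the height at the central 3 of a
bi-infinite word in 1, 2, 3 whose heights are all at most m (`exists_biinfinite`). The bound 3.84
excludes the words 13 and 31, so both fractions lie in X_3({13, 31}). It remains to see that for m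
outside L one of them, plus 3, lies in a fixed countable set.

Letters 1 and 2 have height at most 7/2 < √13, so the full shift on {1, 2} is harmless. If every
prefix of both halves can be continued into it with heights at most m + ε, then ever longer windows
around the centre can be concatenated into one sequence whose heights have upper limit m, and m lies
in L (`mem_lagrangeSpectrum_of_connects`).

So for m outside L one half has a prefix that cannot be continued in this way. But if two admissible
sequences share a prefix, cutting at their first difference and going on with 1, 2, 1, 2, … gives an
admissible sequence between them (`Admissible.exists_between`). Hence that half is the only
admissible sequence with its prefix. After the height bound and the value of the other half are
replaced by nearby rationals, it is determined by countable data (`Admissible.mem_isolatedValues`,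
`countable_isolatedValues`). -/

/-! ### Continued fractions with letters 1, 2, 3. -/

/-- All letters of the sequence lie in `{1, 2, 3}`. -/
def Digits (a : ℕ → ℕ) : Prop := ∀ n, 1 ≤ a n ∧ a n ≤ 3

/-- Neither of the words `13` and `31` occurs in the sequence. -/
def NoThreeOne (a : ℕ → ℕ) : Prop :=
  ∀ n, ¬ (a n = 1 ∧ a (n + 1) = 3) ∧ ¬ (a n = 3 ∧ a (n + 1) = 1)

/-- The sequence with its first `k` letters removed. -/
def shift (k : ℕ) (a : ℕ → ℕ) : ℕ → ℕ := fun i => a (k + i)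

theorem shift_apply (k i : ℕ) (a : ℕ → ℕ) : shift k a i = a (k + i) := rfl

theorem shift_zero (a : ℕ → ℕ) : shift 0 a = a := by
  funext i; simp [shift]

theorem shift_shift (k l : ℕ) (a : ℕ → ℕ) : shift k (shift l a) = shift (l + k) a := by
  funext i; simp [shift, add_assoc]

theorem Digits.shift {a : ℕ → ℕ} (h : Digits a) (k : ℕ) : Digits (shift k a) :=
  fun n => h (k + n)

theorem NoThreeOne.shift {a : ℕ → ℕ} (h : NoThreeOne a) (k : ℕ) : NoThreeOne (shift k a) :=
  fun n => h (k + n)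

theorem Digits.cast {a : ℕ → ℕ} (h : Digits a) (n : ℕ) : (1 : ℝ) ≤ a n ∧ (a n : ℝ) ≤ 3 := by
  exact_mod_cast h n

/-- The finite continued fraction `[0; a 0, …, a (n - 1) + t]`. -/
def foldCF : ℕ → (ℕ → ℕ) → ℝ → ℝ
  | 0, _, t => t
  | n + 1, a, t => 1 / (a 0 + foldCF n (shift 1 a) t)

theorem foldCF_succ_right (n : ℕ) (a : ℕ → ℕ) (t : ℝ) :
    foldCF (n + 1) a t = foldCF n a (1 / (a n + t)) := by
  induction n generalizing a with
  | zero => simp [foldCF]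
  | succ n ih =>
    rw [foldCF, ih, foldCF, shift_apply, add_comm 1 n]

theorem step_mem {d : ℕ} (hd : 1 ≤ d ∧ d ≤ 3) {t : ℝ} (h0 : 0 ≤ t) (h1 : t ≤ 1) :
    1 / 4 ≤ 1 / (d + t) ∧ 1 / (d + t) ≤ 1 := by
  have h : (1 : ℝ) ≤ d ∧ (d : ℝ) ≤ 3 := by exact_mod_cast hd
  constructor
  · apply one_div_le_one_div_of_le <;> linarith
  · rw [div_le_one] <;> linarith

theorem abs_step_sub_le_of_nonneg {d : ℕ} (hd : 1 ≤ d) {s t : ℝ} (hs : 0 ≤ s) (ht : 0 ≤ t) :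
    |1 / (d + s) - 1 / (d + t)| ≤ |s - t| := by
  have h : (1 : ℝ) ≤ d := by exact_mod_cast hd
  have e : 1 / (d + s) - 1 / (d + t) = (t - s) / ((d + s) * (d + t)) := by
    have : (d : ℝ) + s ≠ 0 := by linarith
    have : (d : ℝ) + t ≠ 0 := by linarith
    field_simp; ring
  have hp : (1 : ℝ) ≤ (d + s) * (d + t) := by nlinarith
  rw [e, abs_div, abs_of_pos (show (0 : ℝ) < (d + s) * (d + t) by linarith), abs_sub_comm s t]
  exact div_le_self (abs_nonneg _) hp

/-- Both denominators are at least 1 + 1/4, whence the rate 16/25 = (4/5)². This contraction drives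
all the limits below. -/
theorem abs_step_sub_le {d : ℕ} (hd : 1 ≤ d) {s t : ℝ} (hs : 1 / 4 ≤ s) (ht : 1 / 4 ≤ t) :
    |1 / (d + s) - 1 / (d + t)| ≤ 16 / 25 * |s - t| := by
  have h : (1 : ℝ) ≤ d := by exact_mod_cast hd
  have e : 1 / (d + s) - 1 / (d + t) = (t - s) / ((d + s) * (d + t)) := by
    have : (d : ℝ) + s ≠ 0 := by linarith
    have : (d : ℝ) + t ≠ 0 := by linarith
    field_simp; ring
  have hp : (25 / 16 : ℝ) ≤ (d + s) * (d + t) := by nlinarith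
  rw [e, abs_div, abs_of_pos (show (0 : ℝ) < (d + s) * (d + t) by linarith), abs_sub_comm s t,
    div_le_iff₀ (by linarith)]
  nlinarith [abs_nonneg (t - s)]

theorem foldCF_mem (n : ℕ) {a : ℕ → ℕ} (ha : Digits a) {t : ℝ} (h0 : 1 / 4 ≤ t) (h1 : t ≤ 1) :
    1 / 4 ≤ foldCF n a t ∧ foldCF n a t ≤ 1 := by
  induction n generalizing a with
  | zero => exact ⟨h0, h1⟩
  | succ n ih =>
    have := ih (ha.shift 1)
    exact step_mem (ha 0) (by linarith) this.2

theorem abs_foldCF_sub_le (n : ℕ) {a : ℕ → ℕ} (ha : Digits a) {s t : ℝ} (hs : 1 / 4 ≤ s)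
    (hs' : s ≤ 1) (ht : 1 / 4 ≤ t) (ht' : t ≤ 1) :
    |foldCF n a s - foldCF n a t| ≤ (16 / 25) ^ n := by
  induction n generalizing a with
  | zero =>
    simp only [foldCF, pow_zero]
    rw [abs_le]; constructor <;> linarith
  | succ n ih =>
    have h1 := (foldCF_mem n (ha.shift 1) hs hs').1
    have h2 := (foldCF_mem n (ha.shift 1) ht ht').1
    calc _ ≤ 16 / 25 * |foldCF n (shift 1 a) s - foldCF n (shift 1 a) t| :=
          abs_step_sub_le (ha 0).1 h1 h2
      _ ≤ 16 / 25 * (16 / 25) ^ n := by gcongr; exact ih (ha.shift 1)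
      _ = _ := by ring

/-- The value of the infinite continued fraction `[0; a 0, a 1, …]`. -/
def cf (a : ℕ → ℕ) : ℝ := limUnder atTop (fun n => foldCF n a 1)

theorem tendsto_foldCF_one {a : ℕ → ℕ} (ha : Digits a) :
    Tendsto (fun n => foldCF n a 1) atTop (𝓝 (cf a)) := by
  apply CauchySeq.tendsto_limUnder
  apply cauchySeq_of_le_geometric (16 / 25) 1 (by norm_num)
  intro n
  rw [Real.dist_eq, foldCF_succ_right, one_mul]
  have := step_mem (ha n) (t := 1) (by norm_num) le_rfl
  exact abs_foldCF_sub_le n ha (by norm_num) le_rfl this.1 this.2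

theorem cf_mem_aux {a : ℕ → ℕ} (ha : Digits a) : 1 / 4 ≤ cf a ∧ cf a ≤ 1 :=
  ⟨ge_of_tendsto' (tendsto_foldCF_one ha)
      fun n => (foldCF_mem n ha (by norm_num) le_rfl).1,
    le_of_tendsto' (tendsto_foldCF_one ha)
      fun n => (foldCF_mem n ha (by norm_num) le_rfl).2⟩

theorem cf_eq {a : ℕ → ℕ} (ha : Digits a) : cf a = 1 / (a 0 + cf (shift 1 a)) := by
  have h1 := (tendsto_foldCF_one ha).comp (tendsto_add_atTop_nat 1)
  have h2 := tendsto_foldCF_one (ha.shift 1)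
  have h3 : (a 0 : ℝ) + cf (shift 1 a) ≠ 0 := by
    have := (ha.cast 0).1
    have := (cf_mem_aux (ha.shift 1)).1
    linarith
  exact tendsto_nhds_unique h1 (Tendsto.div tendsto_const_nhds (h2.const_add (a 0 : ℝ)) h3)

theorem cf_shift_eq {a : ℕ → ℕ} (ha : Digits a) (n : ℕ) :
    cf (shift n a) = 1 / (a n + cf (shift (n + 1) a)) := by
  rw [cf_eq (ha.shift n), shift_shift]; rfl

theorem quarter_le_cf {a : ℕ → ℕ} (ha : Digits a) : 1 / 4 ≤ cf a := (cf_mem_aux ha).1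

theorem cf_le {a : ℕ → ℕ} (ha : Digits a) : cf a ≤ 4 / 5 := by
  rw [cf_eq ha]
  have := (ha.cast 0).1
  have := quarter_le_cf (ha.shift 1)
  rw [div_le_iff₀] <;> linarith

theorem cf_pos {a : ℕ → ℕ} (ha : Digits a) : 0 < cf a := by
  linarith [quarter_le_cf ha]

theorem cf_eq_foldCF (n : ℕ) {a : ℕ → ℕ} (ha : Digits a) :
    cf a = foldCF n a (cf (shift n a)) := by
  induction n generalizing a with
  | zero => simp [foldCF, shift_zero]
  | succ n ih =>
    rw [cf_eq ha, foldCF, ih (ha.shift 1), shift_shift, add_comm 1 n]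

/-- A sequence of numbers of `[0, 1]` satisfying the recursion of the complete quotients of a
continued fraction consists of the values of its tails. -/
theorem eq_cf_of_recursion {a : ℕ → ℕ} (ha : Digits a) {x : ℕ → ℝ} (h0 : ∀ n, 0 ≤ x n)
    (h1 : ∀ n, x n ≤ 1) (hx : ∀ n, x n = 1 / (a n + x (n + 1))) (k : ℕ) :
    x k = cf (shift k a) := by
  have hq : ∀ n, 1 / 4 ≤ x n := fun n => by
    rw [hx n]; exact (step_mem (ha n) (h0 _) (h1 _)).1
  have key : ∀ n k, |x k - cf (shift k a)| ≤ (16 / 25) ^ n := by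
    intro n
    induction n with
    | zero =>
      intro k
      have := cf_mem_aux (ha.shift k)
      have := h1 k
      have := hq k
      rw [pow_zero, abs_le]; constructor <;> linarith
    | succ n ih =>
      intro k
      rw [hx k, cf_shift_eq ha k]
      calc _ ≤ 16 / 25 * |x (k + 1) - cf (shift (k + 1) a)| :=
            abs_step_sub_le (ha k).1 (hq _) (quarter_le_cf (ha.shift _))
        _ ≤ 16 / 25 * (16 / 25) ^ n := by gcongr; exact ih _
        _ = _ := by ring
  have hl : Tendsto (fun n : ℕ => (16 / 25 : ℝ) ^ n) atTop (𝓝 0) :=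
    tendsto_pow_atTop_nhds_zero_of_lt_one (by norm_num) (by norm_num)
  have := ge_of_tendsto' hl fun n => key n k
  have := abs_nonpos_iff.1 this
  linarith

theorem abs_cf_sub_le (k : ℕ) {a b : ℕ → ℕ} (ha : Digits a) (hb : Digits b)
    (h : ∀ i < k, a i = b i) : |cf a - cf b| ≤ (16 / 25) ^ k := by
  induction k generalizing a b with
  | zero =>
    have := cf_mem_aux ha
    have := cf_mem_aux hb
    rw [pow_zero, abs_le]; constructor <;> linarith
  | succ k ih =>
    rw [cf_eq ha, cf_eq hb, h 0 (by omega)]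
    calc _ ≤ 16 / 25 * |cf (shift 1 a) - cf (shift 1 b)| :=
          abs_step_sub_le (hb 0).1 (quarter_le_cf (ha.shift _)) (quarter_le_cf (hb.shift _))
      _ ≤ 16 / 25 * (16 / 25) ^ k := by
          gcongr; exact ih (ha.shift 1) (hb.shift 1) fun i hi => h _ (by omega)
      _ = _ := by ring

theorem step_mem_uIcc {d : ℕ} (hd : 1 ≤ d) {s t u : ℝ} (hs : 0 ≤ s) (hu : 0 ≤ u)
    (ht : t ∈ Set.uIcc s u) : 1 / (d + t) ∈ Set.uIcc (1 / (d + s)) (1 / (d + u)) := by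
  have h : (1 : ℝ) ≤ d := by exact_mod_cast hd
  rw [Set.mem_uIcc] at ht ⊢
  rcases ht with ht | ht
  · right
    constructor <;> apply one_div_le_one_div_of_le <;> linarith
  · left
    constructor <;> apply one_div_le_one_div_of_le <;> linarith

/-- If three sequences have the same first `k` letters, the order relation `between` for the
values of the sequences is that for the tails. -/
theorem cf_mem_uIcc (k : ℕ) {a b c : ℕ → ℕ} (ha : Digits a) (hb : Digits b) (hc : Digits c)
    (hab : ∀ i < k, a i = b i) (hac : ∀ i < k, a i = c i)
    (h : cf (shift k a) ∈ Set.uIcc (cf (shift k b)) (cf (shift k c))) :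
    cf a ∈ Set.uIcc (cf b) (cf c) := by
  induction k generalizing a b c with
  | zero => simpa [shift_zero] using h
  | succ k ih =>
    rw [cf_eq ha, cf_eq hb, cf_eq hc, ← hab 0 (by omega), ← hac 0 (by omega)]
    apply step_mem_uIcc (ha 0).1 (cf_pos (hb.shift 1)).le (cf_pos (hc.shift 1)).le
    apply ih (ha.shift 1) (hb.shift 1) (hc.shift 1) (fun i hi => hab _ (by omega))
      (fun i hi => hac _ (by omega))
    simpa [shift_shift, add_comm 1 k] using h

/-! ### Pasts and heights. -/

/-- The value `[0; a (n - 1), …, a 1, a 0 + ⋯]` of the reversed first `n` letters, when `s` is the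
value of what precedes. -/
def pastCF (a : ℕ → ℕ) (s : ℝ) : ℕ → ℝ
  | 0 => s
  | n + 1 => 1 / (a n + pastCF a s n)

/-- The height `a n + [0; a (n + 1), …] + [0; a (n - 1), …]` at the letter `a n`, when `s` is the
value of what precedes `a 0`. -/
def height (a : ℕ → ℕ) (s : ℝ) (n : ℕ) : ℝ := a n + cf (shift (n + 1) a) + pastCF a s n

theorem pastCF_mem {a : ℕ → ℕ} (ha : Digits a) {s : ℝ} (h0 : 0 ≤ s) (h1 : s ≤ 1) (n : ℕ) :
    0 ≤ pastCF a s n ∧ pastCF a s n ≤ 1 := by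
  induction n with
  | zero => exact ⟨h0, h1⟩
  | succ n ih =>
    have := step_mem (ha n) ih.1 ih.2
    exact ⟨by simp only [pastCF]; linarith, this.2⟩

theorem quarter_le_pastCF {a : ℕ → ℕ} (ha : Digits a) {s : ℝ} (h0 : 0 ≤ s) (h1 : s ≤ 1) {n : ℕ}
    (hn : 0 < n) : 1 / 4 ≤ pastCF a s n := by
  obtain ⟨n, rfl⟩ := Nat.exists_eq_succ_of_ne_zero hn.ne'
  have := pastCF_mem ha h0 h1 n
  exact (step_mem (ha n) this.1 this.2).1

theorem pastCF_congr {a b : ℕ → ℕ} (s : ℝ) {n : ℕ} (h : ∀ i < n, a i = b i) :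
    pastCF a s n = pastCF b s n := by
  induction n with
  | zero => rfl
  | succ n ih => rw [pastCF, pastCF, h n (by omega), ih fun i hi => h i (by omega)]

theorem pastCF_add (a : ℕ → ℕ) (s : ℝ) (k n : ℕ) :
    pastCF a s (k + n) = pastCF (shift k a) (pastCF a s k) n := by
  induction n with
  | zero => rfl
  | succ n ih => rw [← add_assoc, pastCF, pastCF, ih]; rfl

theorem abs_pastCF_sub_le {a : ℕ → ℕ} (ha : Digits a) {s t : ℝ} (hs : 0 ≤ s) (hs' : s ≤ 1)
    (ht : 0 ≤ t) (ht' : t ≤ 1) (n : ℕ) : |pastCF a s n - pastCF a t n| ≤ |s - t| := by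
  induction n with
  | zero => exact le_rfl
  | succ n ih =>
    exact (abs_step_sub_le_of_nonneg (ha n).1 (pastCF_mem ha hs hs' n).1
      (pastCF_mem ha ht ht' n).1).trans ih

theorem abs_pastCF_sub_cf_le {a b : ℕ → ℕ} (ha : Digits a) (hb : Digits b) {s : ℝ} {n : ℕ} (k : ℕ)
    (h : ∀ i < k, b i = a (n + k - 1 - i)) (hp : 1 / 4 ≤ pastCF a s n) (hp' : pastCF a s n ≤ 1) :
    |pastCF a s (n + k) - cf b| ≤ (16 / 25) ^ k := by
  have hmem : ∀ k, 1 / 4 ≤ pastCF a s (n + k) ∧ pastCF a s (n + k) ≤ 1 := by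
    intro k
    induction k with
    | zero => exact ⟨hp, hp'⟩
    | succ k ih => exact step_mem (ha (n + k)) (le_trans (by norm_num) ih.1) ih.2
  induction k generalizing b with
  | zero =>
    have := cf_mem_aux hb
    have := hmem 0
    rw [pow_zero, abs_le]; constructor <;> linarith
  | succ k ih =>
    rw [← add_assoc, pastCF, cf_eq hb, h 0 (by omega)]
    have e : n + (k + 1) - 1 - 0 = n + k := by omega
    rw [e]
    calc _ ≤ 16 / 25 * |pastCF a s (n + k) - cf (shift 1 b)| :=
          abs_step_sub_le (ha _).1 (hmem k).1 (quarter_le_cf (hb.shift _))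
      _ ≤ 16 / 25 * (16 / 25) ^ k := by
          gcongr
          refine ih (hb.shift 1) fun i hi => ?_
          rw [shift_apply, h _ (by omega)]
          congr 1; omega
      _ = _ := by ring

/-- Reading backwards exchanges future and past. This serves the left half of a window, which is
stored reversed. -/
theorem cf_shift_eq_pastCF {a b : ℕ → ℕ} (ha : Digits a) {c j : ℕ} (hj : j ≤ c + 1)
    (h : ∀ i < j, b i = a (c - i)) :
    cf (shift (c + 1 - j) a) = pastCF b (cf (shift (c + 1) a)) j := by
  induction j with
  | zero => rfl
  | succ j ih =>
    rw [pastCF, ← ih (by omega) fun i hi => h i (by omega), cf_shift_eq ha, h j (by omega)]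
    have e1 : c + 1 - (j + 1) = c - j := by omega
    have e2 : c - j + 1 = c + 1 - j := by omega
    rw [e1, e2]

theorem third_le_cf {a : ℕ → ℕ} (ha : Digits a) (h : a 0 ≤ 2) : 1 / 3 ≤ cf a := by
  rw [cf_eq ha]
  have h1 : (a 0 : ℝ) ≤ 2 := by exact_mod_cast h
  have := (ha.cast 0).1
  have := cf_le (ha.shift 1)
  have := cf_pos (ha.shift 1)
  rw [div_le_div_iff₀] <;> linarith

/-- A value above 3/4 needs a first letter 1 and then a tail below 1/3, hence a second letter 3. -/
theorem cf_le_three_quarters {a : ℕ → ℕ} (ha : Digits a) (h : ¬ (a 0 = 1 ∧ a 1 = 3)) :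
    cf a ≤ 3 / 4 := by
  rw [cf_eq ha]
  have hp := cf_pos (ha.shift 1)
  rcases Nat.lt_or_ge 1 (a 0) with h1 | h1
  · have : (2 : ℝ) ≤ a 0 := by exact_mod_cast h1
    rw [div_le_div_iff₀] <;> linarith
  · have h0 := ha 0
    have h1' := ha 1
    have : 1 / 3 ≤ cf (shift 1 a) := third_le_cf (ha.shift 1) (by
      simp only [shift_apply, add_zero]; omega)
    have := (ha.cast 0).1
    rw [div_le_div_iff₀] <;> linarith

/-- Since `s` is arbitrary, a single letter 1 preceded by `s = 0` would give 1. Two letters are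
therefore required, or one letter equal to 3. -/
theorem pastCF_le_three_quarters {a : ℕ → ℕ} (ha : Digits a) (hn : NoThreeOne a) {s : ℝ}
    (h0 : 0 ≤ s) (h1 : s ≤ 1) {n : ℕ} (h : 2 ≤ n ∨ 1 ≤ n ∧ a 0 = 3) : pastCF a s n ≤ 3 / 4 := by
  obtain ⟨n, rfl⟩ : ∃ k, n = k + 1 := ⟨n - 1, by omega⟩
  rw [pastCF]
  have hp := pastCF_mem ha h0 h1 n
  rcases Nat.lt_or_ge 1 (a n) with h2 | h2
  · have : (2 : ℝ) ≤ a n := by exact_mod_cast h2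
    rw [div_le_div_iff₀] <;> linarith
  · have h0' := (ha n).1
    have hn0 : n ≠ 0 := by
      rintro rfl
      omega
    obtain ⟨n, rfl⟩ := Nat.exists_eq_succ_of_ne_zero hn0
    have h3 : a n ≤ 2 := by
      have := (hn n).2
      have := (ha n).2
      simp only [Nat.succ_eq_add_one] at *
      omega
    have h3' : (a n : ℝ) ≤ 2 := by exact_mod_cast h3
    have hq := pastCF_mem ha h0 h1 n
    have := (ha.cast n).1
    have : 1 / 3 ≤ pastCF a s (n + 1) := by
      rw [pastCF, div_le_div_iff₀] <;> linarith
    have := (ha.cast (n + 1)).1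
    simp only [Nat.succ_eq_add_one] at *
    rw [div_le_div_iff₀] <;> linarith

/-- The bound is 2 + 3/4 + 3/4. As it is below √13, only the letters 3 need attention later. -/
theorem height_le_of_le_two {a : ℕ → ℕ} (ha : Digits a) (hn : NoThreeOne a) {s : ℝ}
    (h0 : 0 ≤ s) (h1 : s ≤ 1) {n : ℕ} (h : 2 ≤ n ∨ a 0 = 3) (h2 : a n ≤ 2) :
    height a s n ≤ 7 / 2 := by
  have h3 : (a n : ℝ) ≤ 2 := by exact_mod_cast h2
  have h4 := cf_le_three_quarters (ha.shift (n + 1)) (hn (n + 1)).1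
  have h5 : pastCF a s n ≤ 3 / 4 := by
    apply pastCF_le_three_quarters ha hn h0 h1
    rcases h with h | h
    · exact Or.inl h
    · right
      refine ⟨?_, h⟩
      by_contra hc
      have : n = 0 := by omega
      subst this
      omega
  unfold height
  linarith

/-! ### The largest value without 13 and 31. -/

/-- The sequence `1, 2, 1, 2, …`. -/
def oneTwo : ℕ → ℕ := fun n => if n % 2 = 0 then 1 else 2

theorem digits_oneTwo : Digits oneTwo := by
  intro n; unfold oneTwo; split_ifs <;> omega

theorem oneTwo_le_two (n : ℕ) : oneTwo n ≤ 2 := by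
  unfold oneTwo; split_ifs <;> omega

theorem shift_two_oneTwo : shift 2 oneTwo = oneTwo := by
  funext n; simp [shift, oneTwo]

theorem cf_oneTwo : cf oneTwo = 1 / (1 + 1 / (2 + cf oneTwo)) := by
  conv_lhs => rw [cf_eq digits_oneTwo, cf_eq (digits_oneTwo.shift 1), shift_shift,
    shift_two_oneTwo]
  simp [shift, oneTwo]

/-- Among the sequences with letters in `{1, 2, 3}` and without `13` and `31`, the periodic
sequence `1, 2, 1, 2, …` has the largest value. -/
theorem cf_le_cf_oneTwo {a : ℕ → ℕ} (ha : Digits a) (hn : NoThreeOne a) : cf a ≤ cf oneTwo := by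
  have hm := cf_oneTwo
  have hm0 := cf_pos digits_oneTwo
  have hm1 : 1 / 2 ≤ cf oneTwo := by
    rw [hm]
    apply one_div_le_one_div_of_le (by positivity)
    have : 1 / (2 + cf oneTwo) ≤ 1 := by rw [div_le_one] <;> linarith
    linarith
  set M := cf oneTwo with hM
  -- Two letters are removed at a time: `M` is the fixed point of the increasing contraction t ↦ 1 /
  -- (1 + 1 / (2 + t)), which bounds `cf a` by its value at `cf (shift 2 a)` when `a 0 = 1`.
  have key : ∀ n : ℕ, ∀ a : ℕ → ℕ, Digits a → NoThreeOne a → cf a ≤ M + (16 / 25) ^ n := by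
    intro n
    induction n with
    | zero =>
      intro a ha _
      have := cf_le ha
      rw [pow_zero]; linarith
    | succ n ih =>
      intro a ha hn
      have hpow : (0 : ℝ) < (16 / 25) ^ n := by positivity
      have hp1 := cf_pos (ha.shift 1)
      have hp2 := cf_pos (ha.shift 2)
      rcases Nat.lt_or_ge 1 (a 0) with h1 | h1
      · have : (2 : ℝ) ≤ a 0 := by exact_mod_cast h1
        have : cf a ≤ 1 / 2 := by
          rw [cf_eq ha, div_le_div_iff₀] <;> linarith
        rw [pow_succ]; nlinarith
      · have h0 : a 0 = 1 := le_antisymm h1 (ha 0).1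
        have h2 : a 1 ≤ 2 := by
          have := (hn 0).1
          have := (ha 1).2
          simp only [zero_add] at *
          omega
        have h2' : (a 1 : ℝ) ≤ 2 := by exact_mod_cast h2
        have h3 : (1 : ℝ) ≤ a 1 := (ha.cast 1).1
        have e : cf a = 1 / (1 + 1 / (a 1 + cf (shift 2 a))) := by
          rw [cf_eq ha, cf_shift_eq ha 1, h0]; norm_num
        have hi := ih _ (ha.shift 2) (hn.shift 2)
        have hle : cf a ≤ 1 / (1 + 1 / (2 + (M + (16 / 25) ^ n))) := by
          rw [e]
          apply one_div_le_one_div_of_le (by positivity)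
          have : 1 / (2 + (M + (16 / 25) ^ n)) ≤ 1 / ((a 1 : ℝ) + cf (shift 2 a)) := by
            apply one_div_le_one_div_of_le <;> linarith
          linarith
        refine hle.trans ?_
        have h4 : (1 : ℝ) / (1 + 1 / (2 + (M + (16 / 25) ^ n))) ≤
            1 / (1 + 1 / (2 + M)) + 16 / 25 * (16 / 25) ^ n := by
          generalize (16 / 25 : ℝ) ^ n = t at hpow
          have e1 : (1 : ℝ) / (1 + 1 / (2 + (M + t))) = 1 - 1 / (3 + M + t) := by
            field_simp; ring
          have e2 : (1 : ℝ) / (1 + 1 / (2 + M)) = 1 - 1 / (3 + M) := by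
            field_simp; ring
          have e3 : 1 / (3 + M) - 1 / (3 + M + t) = t / ((3 + M) * (3 + M + t)) := by
            field_simp; ring
          have : t / ((3 + M) * (3 + M + t)) ≤ 16 / 25 * t := by
            rw [div_le_iff₀ (by positivity)]
            nlinarith [mul_pos hpow hm0, mul_pos hpow hpow, mul_pos (mul_pos hpow hm0) hm0,
              mul_pos (mul_pos hpow hm0) hpow]
          rw [e1, e2]; linarith
        rw [← hm] at h4
        rw [pow_succ]; linarith
  have hl : Tendsto (fun n : ℕ => M + (16 / 25 : ℝ) ^ n) atTop (𝓝 (M + 0)) :=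
    (tendsto_pow_atTop_nhds_zero_of_lt_one (by norm_num) (by norm_num)).const_add M
  have := ge_of_tendsto' hl fun n => key n a ha hn
  linarith

/-! ### Agreement of `cf` with the limit of `contFracOf`. -/

theorem convs'Aux_ofStream (a : ℕ → ℕ) (n : ℕ) :
    GenContFract.convs'Aux
      (Stream'.Seq.ofStream (fun n => (⟨1, (a n : ℝ)⟩ : GenContFract.Pair ℝ))) n =
      foldCF n a 0 := by
  induction n generalizing a with
  | zero => rfl
  | succ n ih =>
    have ht : (Stream'.Seq.ofStream (fun n => (⟨1, (a n : ℝ)⟩ : GenContFract.Pair ℝ))).tail =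
        Stream'.Seq.ofStream (fun n => (⟨1, (shift 1 a n : ℝ)⟩ : GenContFract.Pair ℝ)) := by
      ext1 n
      rw [Stream'.Seq.get?_tail]
      simp only [shift_apply, add_comm 1]
      rfl
    rw [foldCF, ← ih, ← ht]
    rfl

theorem convs_contFracOf {a : ℕ → ℕ} (ha : Digits a) (n : ℕ) :
    (contFracOf a).convs n = foldCF n a 0 := by
  rw [GenContFract.convs_eq_convs']
  · rw [GenContFract.convs', ← convs'Aux_ofStream]
    simp [contFracOf]
  · intro gp m _ hm
    have : gp = ⟨1, (a m : ℝ)⟩ := by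
      have : some (⟨1, (a m : ℝ)⟩ : GenContFract.Pair ℝ) = some gp := hm
      exact (Option.some.inj this).symm
    subst this
    exact ⟨one_pos, by have := (ha.cast m).1; simp only; linarith⟩

theorem tendsto_convs_contFracOf {a : ℕ → ℕ} (ha : Digits a) :
    Tendsto (fun n => (contFracOf a).convs n) atTop (𝓝 (cf a)) := by
  -- A convergent ends in the tail 0, outside the interval [1/4, 1] where the contraction holds. One
  -- more letter turns this tail into `1 / a n`.
  rw [← tendsto_add_atTop_iff_nat 1]
  have hl : Tendsto (fun n : ℕ => (16 / 25 : ℝ) ^ n) atTop (𝓝 0) :=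
    tendsto_pow_atTop_nhds_zero_of_lt_one (by norm_num) (by norm_num)
  rw [tendsto_iff_dist_tendsto_zero]
  refine squeeze_zero (fun _ => dist_nonneg) (fun n => ?_) hl
  rw [convs_contFracOf ha, foldCF_succ_right, cf_eq_foldCF n ha, Real.dist_eq]
  have h1 := step_mem (ha n) (t := 0) le_rfl zero_le_one
  have h2 := cf_mem_aux (ha.shift n)
  exact abs_foldCF_sub_le n ha h1.1 h1.2 h2.1 h2.2

theorem cf_mem_XSet {a : ℕ → ℕ} (ha : Digits a) (hn : NoThreeOne a) :
    cf a ∈ XSet 3 {[1, 3], [3, 1]} := by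
  refine ⟨a, fun n => ha n, ?_, tendsto_convs_contFracOf ha⟩
  rintro w hw ⟨n, h⟩
  rcases hw with rfl | hw
  · exact (hn n).1 ⟨h ⟨0, by simp⟩, h ⟨1, by simp⟩⟩
  · rw [Set.mem_singleton_iff] at hw
    subst hw
    exact (hn n).2 ⟨h ⟨0, by simp⟩, h ⟨1, by simp⟩⟩

/-! ### Convergents and the Lagrange spectrum. -/

/-- The numerators of the convergents of `[0; a 0, a 1, …]` with `n` and with `n - 1` letters. -/
def convNum (a : ℕ → ℕ) : ℕ → ℤ × ℤ
  | 0 => (0, 1)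
  | n + 1 => (a n * (convNum a n).1 + (convNum a n).2, (convNum a n).1)

/-- The denominators of the convergents with `n` and with `n - 1` letters. -/
def convDen (a : ℕ → ℕ) : ℕ → ℤ × ℤ
  | 0 => (1, 0)
  | n + 1 => (a n * (convDen a n).1 + (convDen a n).2, (convDen a n).1)

theorem convNum_succ (a : ℕ → ℕ) (n : ℕ) :
    convNum a (n + 1) = convDen (shift 1 a) n := by
  induction n with
  | zero => simp [convNum, convDen]
  | succ n ih =>
    rw [convNum, ih, convDen, shift_apply, add_comm 1 n]

theorem convDen_succ (a : ℕ → ℕ) (n : ℕ) :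
    convDen a (n + 1) = ((a 0 : ℤ) * (convDen (shift 1 a) n).1 + (convNum (shift 1 a) n).1,
      (a 0 : ℤ) * (convDen (shift 1 a) n).2 + (convNum (shift 1 a) n).2) := by
  induction n with
  | zero => simp [convNum, convDen]
  | succ n ih =>
    rw [convDen, ih]
    simp only [convDen, convNum, shift_apply, add_comm 1 n]
    exact Prod.ext (by simp only; ring) rfl

theorem le_convDen {a : ℕ → ℕ} (ha : Digits a) (n : ℕ) :
    1 ≤ (convDen a n).1 ∧ (n : ℤ) ≤ (convDen a n).1 ∧ 0 ≤ (convDen a n).2 ∧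
      (1 ≤ n → 1 ≤ (convDen a n).2) := by
  induction n with
  | zero => simp [convDen]
  | succ n ih =>
    obtain ⟨h1, h2, h3, h4⟩ := ih
    have hd : (1 : ℤ) ≤ a n := by exact_mod_cast (ha n).1
    have h5 : (convDen a n).1 ≤ a n * (convDen a n).1 := by nlinarith
    simp only [convDen]
    refine ⟨by linarith, ?_, by linarith, fun _ => h1⟩
    rcases Nat.eq_zero_or_pos n with rfl | hn
    · push_cast; linarith
    · have := h4 hn
      push_cast; linarith

theorem convDen_pos {a : ℕ → ℕ} (ha : Digits a) (n : ℕ) : (0 : ℝ) < (convDen a n).1 := by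
  have := (le_convDen ha n).1
  exact_mod_cast (by linarith : 0 < (convDen a n).1)

theorem conv_det (a : ℕ → ℕ) (n : ℕ) :
    |(convNum a n).1 * (convDen a n).2 - (convNum a n).2 * (convDen a n).1| = 1 := by
  induction n with
  | zero => simp [convNum, convDen]
  | succ n ih =>
    rw [← ih, abs_sub_comm]
    simp only [convNum, convDen]
    congr 1; ring

/-- Dividing the recursion of the denominators by the current one gives the recursion of `pastCF`.
The start value is 0 because nothing precedes `a 0`. -/
theorem pastCF_zero_eq {a : ℕ → ℕ} (ha : Digits a) (n : ℕ) :
    pastCF a 0 n = (convDen a n).2 / (convDen a n).1 := by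
  induction n with
  | zero => simp [pastCF, convDen]
  | succ n ih =>
    have := convDen_pos ha n
    rw [pastCF, ih, convDen]
    push_cast
    field_simp

/-- This is α = (p_n + t p_{n-1}) / (q_n + t q_{n-1}), with t the n-th tail, cleared of
denominators. -/
theorem conv_relation {a : ℕ → ℕ} (ha : Digits a) (n : ℕ) :
    ((convDen a n).1 * cf a - (convNum a n).1) +
      cf (shift n a) * ((convDen a n).2 * cf a - (convNum a n).2) = 0 := by
  induction n with
  | zero => simp [convNum, convDen, shift_zero]
  | succ n ih =>
    have h := cf_shift_eq ha n
    have h1 := (ha.cast n).1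
    have h2 := cf_pos (ha.shift (n + 1))
    have h3 : (a n : ℝ) + cf (shift (n + 1) a) ≠ 0 := by linarith
    rw [h] at ih
    field_simp at ih
    simp only [convNum, convDen]
    push_cast
    linear_combination ih

/-- Perron's formula, from `conv_relation` and the determinant ±1: heights measure exactly how well
the convergents approximate. -/
theorem one_div_approx {a : ℕ → ℕ} (ha : Digits a) (n : ℕ) :
    1 / |((convDen a n).1 : ℝ) * ((convDen a n).1 * cf a - (convNum a n).1)| = height a 0 n := by
  have h := conv_relation ha n
  have hq := convDen_pos ha n
  have hx := cf_shift_eq ha n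
  have hx0 := cf_pos (ha.shift n)
  have hd : |((convNum a n).1 : ℝ) * (convDen a n).2 - (convNum a n).2 * (convDen a n).1| = 1 := by
    exact_mod_cast conv_det a n
  have hh : height a 0 n = 1 / cf (shift n a) + pastCF a 0 n := by
    rw [hx, one_div_one_div]; rfl
  have hpos : 0 < height a 0 n := by
    have := (pastCF_mem ha (le_refl (0 : ℝ)) zero_le_one n).1
    rw [hh]; positivity
  have key : ((convDen a n).1 : ℝ) * ((convDen a n).1 * cf a - (convNum a n).1) * height a 0 n =
      -((convNum a n).1 * (convDen a n).2 - (convNum a n).2 * (convDen a n).1) := by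
    rw [hh, pastCF_zero_eq ha]
    field_simp
    linear_combination (convDen a n).1 * h
  have key2 : |((convDen a n).1 : ℝ) * ((convDen a n).1 * cf a - (convNum a n).1)| *
      height a 0 n = 1 := by
    have h1 := congrArg abs key
    rwa [abs_mul, abs_neg, hd, abs_of_pos hpos] at h1
  have : |((convDen a n).1 : ℝ) * ((convDen a n).1 * cf a - (convNum a n).1)| ≠ 0 := by
    intro h0; rw [h0, zero_mul] at key2; exact zero_ne_one key2
  field_simp
  linarith

theorem height_bounds {a : ℕ → ℕ} (ha : Digits a) {s : ℝ} (h0 : 0 ≤ s) (h1 : s ≤ 1) (n : ℕ) :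
    1 ≤ height a s n ∧ height a s n ≤ 5 := by
  have := ha.cast n
  have := cf_mem_aux (ha.shift (n + 1))
  have := pastCF_mem ha h0 h1 n
  unfold height
  constructor <;> linarith

/-- For a rational value with denominator D, |q (q α - p)| is 0 or at least q / D, and q ≥ 2 D after
2 D letters. Both cases contradict a height of at least 1, the first because 1 / 0 = 0. -/
theorem irrational_cf {a : ℕ → ℕ} (ha : Digits a) : Irrational (cf a) := by
  rintro ⟨r, hr⟩
  set n := 2 * r.den with hn
  have h := one_div_approx ha n
  have hb := height_bounds ha (le_refl (0 : ℝ)) zero_le_one n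
  have hq := (le_convDen ha n).2.1
  have hden : (0 : ℝ) < r.den := by exact_mod_cast r.den_pos
  have hr' : cf a = r.num / r.den := by rw [← hr]; exact_mod_cast (Rat.num_div_den r).symm
  set q := (convDen a n).1
  set p := (convNum a n).1
  have hq' : (2 : ℝ) * r.den ≤ q := by
    have : (2 * r.den : ℤ) ≤ q := by rw [hn] at hq; exact_mod_cast hq
    exact_mod_cast this
  have e : (q : ℝ) * (q * cf a - p) = q * ((q * r.num - p * r.den : ℤ) : ℝ) / r.den := by
    rw [hr']; push_cast; field_simp
  have hz : (q * r.num - p * r.den : ℤ) ≠ 0 := by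
    intro hz
    rw [e, hz] at h
    simp at h
    linarith [hb.1]
  have hz1 : (1 : ℝ) ≤ |((q * r.num - p * r.den : ℤ) : ℝ)| := by
    exact_mod_cast Int.one_le_abs hz
  have hge : 2 ≤ |(q : ℝ) * (q * cf a - p)| := by
    rw [e, abs_div, abs_mul, abs_of_pos hden, abs_of_pos (show (0 : ℝ) < q by linarith),
      le_div_iff₀ hden]
    nlinarith
  have : 1 / |(q : ℝ) * (q * cf a - p)| ≤ 1 / 2 := one_div_le_one_div_of_le (by norm_num) hge
  linarith [hb.1]

theorem convergent_natCast_add (d : ℕ) (x : ℝ) (n : ℕ) :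
    ((d : ℝ) + x).convergent n = d + x.convergent n := by
  cases n with
  | zero => simp [Real.convergent]
  | succ n => simp [Real.convergent, add_assoc]

theorem convergent_cf {a : ℕ → ℕ} (ha : Digits a) (n : ℕ) :
    (cf a).convergent n = ((convNum a n).1 : ℚ) / (convDen a n).1 := by
  have hf : ∀ a, Digits a → ⌊cf a⌋ = 0 := fun a ha => by
    rw [Int.floor_eq_zero_iff]
    exact ⟨(cf_pos ha).le, by linarith [cf_le ha]⟩
  induction n generalizing a with
  | zero => simp [Real.convergent, hf a ha, convNum]
  | succ n ih =>
    have hfr : Int.fract (cf a) = cf a := by rw [Int.fract, hf a ha]; simp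
    rw [Real.convergent, hf a ha, hfr, cf_eq ha, one_div, inv_inv, convergent_natCast_add,
      ih (ha.shift 1), convNum_succ, convDen_succ]
    have : (0 : ℚ) < (convDen (shift 1 a) n).1 := by
      have := (le_convDen (ha.shift 1) n).1
      exact_mod_cast (by linarith : 0 < (convDen (shift 1 a) n).1)
    push_cast
    field_simp
    simp

/-- A rational approximation with `1 / |q (q α - p)| > 2` comes from a convergent. -/
theorem exists_conv_of_two_lt {a : ℕ → ℕ} (ha : Digits a) {p q : ℤ}
    (h : 2 < 1 / |(q : ℝ) * (q * cf a - p)|) :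
    ∃ n, ∃ k : ℤ, k ≠ 0 ∧ p = k * (convNum a n).1 ∧ q = k * (convDen a n).1 := by
  have hpos : 0 < |(q : ℝ) * (q * cf a - p)| := by
    by_contra hc
    have : |(q : ℝ) * (q * cf a - p)| = 0 := le_antisymm (not_lt.1 hc) (abs_nonneg _)
    rw [this] at h; norm_num at h
  have hq : q ≠ 0 := by
    rintro rfl; simp at hpos
  have hqR : (q : ℝ) ≠ 0 := by exact_mod_cast hq
  have hlt : |(q : ℝ) * (q * cf a - p)| < 1 / 2 := by
    rw [lt_div_iff₀ hpos] at h; linarith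
  set r : ℚ := (p : ℚ) / q with hr
  have hrR : (r : ℝ) = p / q := by rw [hr]; push_cast; rfl
  have hden : ((r.den : ℤ)) ∣ q := by
    rw [hr, ← Rat.divInt_eq_div]; exact Rat.den_dvd p q
  have hden' : (r.den : ℝ) ^ 2 ≤ (q : ℝ) ^ 2 := by
    have : (r.den : ℤ) ≤ |q| := by
      have := Int.le_of_dvd (abs_pos.2 hq) ((dvd_abs _ _).2 hden)
      exact this
    have h2 : (r.den : ℝ) ≤ |(q : ℝ)| := by exact_mod_cast this
    rw [← sq_abs (q : ℝ)]
    gcongr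
  have hrd : (0 : ℝ) < r.den := by exact_mod_cast r.den_pos
  have happ : |cf a - r| < 1 / (2 * (r.den : ℝ) ^ 2) := by
    have e : (q : ℝ) * (q * cf a - p) = q ^ 2 * (cf a - r) := by rw [hrR]; field_simp
    rw [e, abs_mul, abs_of_nonneg (sq_nonneg (q : ℝ))] at hlt
    rw [lt_div_iff₀ (by positivity)]
    nlinarith [abs_nonneg (cf a - r)]
  -- Legendre's criterion. The fraction p / q need not be in lowest terms, hence the factor `k`.
  obtain ⟨n, hn⟩ := Real.exists_rat_eq_convergent happ
  rw [convergent_cf ha] at hn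
  refine ⟨n, ?_⟩
  have hdn := (le_convDen ha n).1
  have hcop : IsCoprime (convDen a n).1 (convNum a n).1 := by
    have := conv_det a n
    rcases abs_eq (zero_le_one' ℤ) |>.1 this with h1 | h1
    · exact ⟨-(convNum a n).2, (convDen a n).2, by linarith⟩
    · exact ⟨(convNum a n).2, -(convDen a n).2, by linarith⟩
  have hcross : p * (convDen a n).1 = (convNum a n).1 * q := by
    have h1 : ((convDen a n).1 : ℚ) ≠ 0 := by
      exact_mod_cast (by linarith : (convDen a n).1 ≠ 0)
    have h2 : (q : ℚ) ≠ 0 := by exact_mod_cast hq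
    rw [hr, div_eq_div_iff h2 h1] at hn
    exact_mod_cast hn
  have hdvd : (convDen a n).1 ∣ q :=
    hcop.dvd_of_dvd_mul_left ⟨p, by linarith⟩
  obtain ⟨k, hk⟩ := hdvd
  refine ⟨k, ?_, ?_, by linarith⟩
  · rintro rfl; simp at hk; exact hq hk
  · have : (convDen a n).1 ≠ 0 := by linarith
    apply mul_right_cancel₀ this
    rw [hcross, hk]; ring

/-- A number with letters in `{1, 2, 3}` whose heights have upper limit `m > 2` has the value `m`
in the Lagrange spectrum. -/
theorem mem_lagrangeSpectrum {a : ℕ → ℕ} (ha : Digits a) {m : ℝ} (hm : 2 < m)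
    (hup : ∀ δ > 0, ∀ᶠ n in atTop, height a 0 n ≤ m + δ)
    (hlow : ∀ δ > 0, ∃ᶠ n in atTop, m - δ ≤ height a 0 n) : m ∈ lagrangeSpectrum := by
  refine ⟨cf a, irrational_cf ha, le_antisymm ?_ ?_⟩
  · refine EReal.le_of_forall_lt_iff_le.1 fun c hc => ?_
    have hc' : m < c := by exact_mod_cast hc
    apply limsup_le_of_le
    · isBoundedDefault
    obtain ⟨N, hN⟩ := eventually_atTop.1 (hup (c - m) (by linarith))
    -- A value above `c > 2` comes from `k` times a convergent, and heights at most 5 force k² < 4,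
    -- so k = ±1. Only the convergents with `n < N` can violate the bound, and excluding their
    -- finitely many denominators suffices.
    have hfin : (⋃ n ∈ Finset.range N,
        ({(convDen a n).1, -(convDen a n).1} : Set ℤ)).Finite := by
      apply Set.Finite.biUnion (Finset.finite_toSet _)
      intro n _
      exact Set.toFinite _
    have hev : ∀ᶠ q : ℤ in cofinite, q ∉ ⋃ n ∈ Finset.range N,
        ({(convDen a n).1, -(convDen a n).1} : Set ℤ) := hfin.compl_mem_cofinite
    filter_upwards [hev.prod_inr (cofinite : Filter ℤ)] with z hz
    rw [EReal.coe_le_coe_iff]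
    by_contra hlt
    rw [not_le] at hlt
    obtain ⟨n, k, hk, hp, hq⟩ := exists_conv_of_two_lt ha ((hm.trans hc').trans hlt)
    have hval : 1 / |(z.2 : ℝ) * (z.2 * cf a - z.1)| = height a 0 n / (k : ℝ) ^ 2 := by
      rw [← one_div_approx ha n, hp, hq]
      push_cast
      have : (k * (convDen a n).1 : ℝ) * (k * (convDen a n).1 * cf a - k * (convNum a n).1) =
        k ^ 2 * ((convDen a n).1 * ((convDen a n).1 * cf a - (convNum a n).1)) := by ring
      rw [this, abs_mul, abs_of_nonneg (sq_nonneg (k : ℝ)), one_div, mul_inv, div_eq_mul_inv,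
        one_div, mul_comm]
    rw [hval] at hlt
    have hb := height_bounds ha (le_refl (0 : ℝ)) zero_le_one n
    have hk1 : (1 : ℝ) ≤ (k : ℝ) ^ 2 := by
      have : 1 ≤ k ^ 2 := by
        have := Int.one_le_abs hk
        rw [← sq_abs]; nlinarith
      exact_mod_cast this
    have hk2 : k ^ 2 < 4 := by
      rw [lt_div_iff₀ (by linarith)] at hlt
      have : (k : ℝ) ^ 2 < 4 := by nlinarith
      exact_mod_cast this
    have hk3 : k = 1 ∨ k = -1 := by
      have h1 : k < 2 := by nlinarith
      have h2 : -2 < k := by nlinarith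
      omega
    have hn : n < N := by
      by_contra hge
      have := hN n (not_lt.1 hge)
      have : height a 0 n / (k : ℝ) ^ 2 ≤ height a 0 n := div_le_self (by linarith) hk1
      linarith
    apply hz
    simp only [Set.mem_iUnion, Finset.mem_range]
    refine ⟨n, hn, ?_⟩
    rcases hk3 with rfl | rfl
    · left; rw [hq, one_mul]
    · right; rw [hq]; simp
  · refine EReal.ge_of_forall_gt_iff_ge.1 fun c hc => ?_
    have hc' : c < m := by exact_mod_cast hc
    apply le_limsup_of_frequently_le
    · have hden : ∀ a : ℕ → ℕ, Digits a →
          Tendsto (fun n => (convDen a n).1) atTop (cofinite : Filter ℤ) := by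
        intro a ha
        have h : Tendsto (fun n => (convDen a n).1) atTop (atTop : Filter ℤ) :=
          tendsto_atTop_mono (fun n => (le_convDen ha n).2.1) tendsto_natCast_atTop_atTop
        exact h.mono_right atTop_le_cofinite
      have hnum : Tendsto (fun n => (convNum a n).1) atTop (cofinite : Filter ℤ) := by
        rw [← tendsto_add_atTop_iff_nat 1]
        simp only [convNum_succ]
        exact hden _ (ha.shift 1)
      refine (hnum.prodMk (hden a ha)).frequently ?_
      refine (hlow (m - c) (by linarith)).mono fun n hn => ?_
      rw [EReal.coe_le_coe_iff]
      simp only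
      rw [one_div_approx ha n]
      linarith
    · isBoundedDefault

/-! ### Reduction of forms, and the exclusion of 13 and 31. -/

/-- The form `(p - (d + x) q) (p + y q)`, with `0 < x, y < 1`, takes at the nonzero integer vectors
only values at least `1 / m` times the root of its discriminant. -/
def MarkovState (m : ℝ) (d : ℕ) (x y : ℝ) : Prop :=
  0 < x ∧ x < 1 ∧ 0 < y ∧ y < 1 ∧
    ∀ p q : ℤ, (p ≠ 0 ∨ q ≠ 0) → (d + x + y) / m ≤ |((p : ℝ) - (d + x) * q) * (p + y * q)|

namespace MarkovState

variable {m : ℝ} {d : ℕ} {x y : ℝ}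

theorem sum_le (h : MarkovState m d x y) (hm : 0 < m) : d + x + y ≤ m := by
  have := h.2.2.2.2 1 0 (by norm_num)
  simpa [div_le_iff₀ hm] using this

/-- The substitution p ↦ d q - p carries the roots d + x and -y to -x and d + y; it reverses the
direction of reading. -/
theorem mirror (h : MarkovState m d x y) : MarkovState m d y x := by
  obtain ⟨h1, h2, h3, h4, h5⟩ := h
  refine ⟨h3, h4, h1, h2, fun p q hpq => ?_⟩
  have := h5 (d * q - p) q (by
    by_cases hq : q = 0
    · subst hq; simpa using hpq
    · exact Or.inr hq)
  push_cast at this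
  have e : ((d : ℝ) * q - p - (d + x) * q) * (d * q - p + y * q) =
    (p - (d + y) * q) * (p + x * q) := by ring
  rw [e] at this
  rwa [add_right_comm]

/-- One step of Gauss reduction, (p, q) ↦ (q + d p, p). The values and the distance of the roots are
both divided by x (d + y) in absolute value, so the bound with `m` is preserved. -/
theorem next (h : MarkovState m d x y) (hd : 1 ≤ d) (hm : 0 < m) :
    ∃ (b : ℕ) (x' : ℝ), 1 ≤ b ∧ x = 1 / (b + x') ∧ MarkovState m b x' (1 / (d + y)) := by
  obtain ⟨h1, h2, h3, h4, h5⟩ := h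
  have hd' : (1 : ℝ) ≤ d := by exact_mod_cast hd
  have hx : 1 < 1 / x := by rw [lt_div_iff₀ h1]; linarith
  set b := ⌊1 / x⌋₊ with hb
  have hb1 : 1 ≤ b := Nat.le_floor (by push_cast; exact hx.le)
  have hb2 : (b : ℝ) ≤ 1 / x := Nat.floor_le (by linarith)
  have hb3 : 1 / x < b + 1 := Nat.lt_floor_add_one _
  -- If 1 / x were the integer b, the form would vanish at (d b + 1, b).
  have hne : (b : ℝ) ≠ 1 / x := by
    intro hbx
    have := h5 (d * b + 1) b (Or.inr (by omega))
    push_cast at this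
    have e : (d : ℝ) * b + 1 - (d + x) * b = 0 := by rw [hbx]; field_simp; ring
    rw [e, zero_mul, abs_zero] at this
    have : 0 < (d + x + y) / m := by positivity
    linarith
  refine ⟨b, 1 / x - b, hb1, by simp, by have := lt_of_le_of_ne hb2 hne; linarith, by linarith,
    by positivity, ?_, fun p q hpq => ?_⟩
  · rw [div_lt_one] <;> linarith
  · have := h5 (q + d * p) p (by
      by_cases hp : p = 0
      · subst hp; simpa using hpq
      · exact Or.inr hp)
    push_cast at this
    have e : ((q : ℝ) + d * p - (d + x) * p) * (q + d * p + y * p) =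
      -(x * (d + y)) * ((p - (b + (1 / x - b)) * q) * (p + 1 / (d + y) * q)) := by
      field_simp; ring
    have e2 : (b + (1 / x - b) + 1 / (d + y)) / m = ((d + x + y) / m) / (x * (d + y)) := by
      field_simp; ring
    rw [e, abs_mul, abs_neg, abs_of_pos (by positivity : 0 < x * (d + y))] at this
    rw [e2, div_le_iff₀ (by positivity)]
    linarith

theorem bounds (h : MarkovState m d x y) (hd : 1 ≤ d) (hm : 0 < m) (hm4 : m < 4) :
    1 / 4 < x ∧ x < 4 / 5 := by
  have key : ∀ {d : ℕ} {x y : ℝ}, MarkovState m d x y → 1 ≤ d → 1 / 4 < x := by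
    intro d x y h hd
    obtain ⟨b, x', hb, hx, h'⟩ := h.next hd hm
    have hb' : (1 : ℝ) ≤ b := by exact_mod_cast hb
    have := h'.sum_le hm
    have := h'.1
    have := h'.2.2.1
    rw [hx]
    apply one_div_lt_one_div_of_lt <;> linarith
  refine ⟨key h hd, ?_⟩
  obtain ⟨b, x', hb, hx, h'⟩ := h.next hd hm
  have hb' : (1 : ℝ) ≤ b := by exact_mod_cast hb
  have := key h' hb
  rw [hx, div_lt_div_iff₀] <;> linarith

theorem digit_le (h : MarkovState m d x y) (hm : 0 < m) (hm4 : m < 4) : d ≤ 3 := by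
  have := h.sum_le hm
  have := h.1
  have := h.2.2.1
  have : (d : ℝ) < 4 := by linarith
  have : d < 4 := by exact_mod_cast this
  omega

/-- The hypothesis on `x` forces a letter 1. A letter at least 2 after it would give x > 2/3 and a
height above 3 + 2/3 + 1/4 > 3.84. -/
theorem three_one_one (h : MarkovState m 3 x y) (hm : 0 < m) (hm4 : m < 3.84) (hx : 1 / 2 ≤ x) :
    ∃ z, x = 1 / (1 + 1 / (1 + z)) ∧ MarkovState m 1 z (1 / (1 + 1 / (3 + y))) := by
  have hs := h.sum_le hm
  have hy := (h.mirror.bounds (by norm_num) hm (by linarith)).1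
  norm_num at hs
  obtain ⟨b, x1, hb, hx1, h1⟩ := h.next (by norm_num) hm
  have hx1p := h1.1
  have hx1q := h1.2.1
  have hb1 : b = 1 := by
    by_contra hne
    have : (2 : ℝ) ≤ b := by exact_mod_cast (by omega : 2 ≤ b)
    rw [hx1, div_le_div_iff₀ (by norm_num) (by linarith)] at hx
    linarith
  subst hb1
  obtain ⟨c, x2, hc, hx2, h2⟩ := h1.next le_rfl hm
  have hx2p := h2.1
  have hc1 : c = 1 := by
    by_contra hne
    have h2c : (2 : ℝ) ≤ c := by exact_mod_cast (by omega : 2 ≤ c)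
    have : x1 < 1 / 2 := by
      rw [hx2, div_lt_div_iff₀ (by linarith) (by norm_num)]; linarith
    have : 2 / 3 < x := by
      rw [hx1, div_lt_div_iff₀ (by norm_num) (by norm_num; linarith)]; norm_num; linarith
    linarith
  subst hc1
  norm_num at hx1 hx2 h2
  refine ⟨x2, ?_, ?_⟩
  · rw [hx1, hx2]; norm_num
  · norm_num; exact h2

/-- Otherwise the word continues as 311 by `three_one_one`. A lower bound for `y` bounds `x` from
above, and this makes the next letter a 3. At that second 3 of 3113 the height exceeds 3.31 + 0.558
> 3.84. -/
theorem lt_half (h : MarkovState m 3 x y) (hm : 0 < m) (hm4 : m < 3.84) : x < 1 / 2 := by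
  by_contra hx
  rw [not_lt] at hx
  have hm4' : m < 4 := by linarith
  have hs := h.sum_le hm
  norm_num at hs
  have hyb := h.mirror.bounds (by norm_num) hm hm4'
  -- The worst case is y = [0; 3, 1, 1, …] with remaining tail below 4/5, which gives 1 / (3 + 9/14)
  -- = 14/51.
  have hy : 0.2745 < y := by
    obtain ⟨b, y1, hb, hy1, h1⟩ := h.mirror.next (by norm_num) hm
    have hb3 := h1.digit_le hm hm4'
    have hp := h1.1
    have hq := h1.2.1
    have hbp : (1 : ℝ) ≤ b := by exact_mod_cast hb
    rcases Nat.lt_or_ge b 3 with hlt | hge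
    · have : (b : ℝ) ≤ 2 := by exact_mod_cast (by omega : b ≤ 2)
      have : 1 / 3 < y := by
        rw [hy1, div_lt_div_iff₀ (by norm_num) (by linarith)]; linarith
      linarith
    · obtain rfl : b = 3 := by omega
      rcases lt_or_ge y1 (1 / 2) with hlt | hge
      · have : 1 / 3.5 < y := by
          rw [hy1, div_lt_div_iff₀ (by norm_num) (by linarith)]; norm_num; linarith
        norm_num at this ⊢; linarith
      · obtain ⟨z, hz, h2⟩ := h1.three_one_one hm hm4 hge
        have hz1 := (h2.bounds le_rfl hm hm4').2
        have hz0 := h2.1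
        have : y1 < 9 / 14 := by
          have e : y1 = 1 - 1 / (2 + z) := by rw [hz]; field_simp; ring
          have : 5 / 14 < 1 / (2 + z) := by
            rw [div_lt_div_iff₀ (by norm_num) (by linarith)]; linarith
          linarith
        have : 14 / 51 < y := by
          rw [hy1, div_lt_div_iff₀ (by norm_num) (by linarith)]; norm_num; linarith
        norm_num at this ⊢; linarith
  obtain ⟨z, hz, h2⟩ := h.three_one_one hm hm4 hx
  have hz0 := h2.1
  have hzlt : z < 0.302 := by
    have e : x = 1 - 1 / (2 + z) := by rw [hz]; field_simp; ring
    -- Here 0.4345 = 1 - (3.84 - 3 - 0.2745).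
    have h3 : 0.4345 < 1 / (2 + z) := by norm_num at *; linarith
    rw [lt_div_iff₀ (by linarith)] at h3
    norm_num at *; linarith
  obtain ⟨b, w, hb, hw, h3⟩ := h2.next le_rfl hm
  have hbp : (1 : ℝ) ≤ b := by exact_mod_cast hb
  have hw0 := h3.1
  have hw1 := h3.2.1
  have hsum : 3.31 < b + w := by
    rw [hw, div_lt_iff₀ (by linarith)] at hzlt
    norm_num at *; linarith
  obtain rfl : b = 3 := by
    have h4 := h3.digit_le hm hm4'
    by_contra hne
    have : (b : ℝ) ≤ 2 := by exact_mod_cast (by omega : b ≤ 2)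
    norm_num at hsum
    linarith
  have hs3 := h3.sum_le hm
  have hpast : 0.558 < 1 / ((1 : ℕ) + 1 / (1 + 1 / (3 + y))) := by
    have e : 1 / (((1 : ℕ) : ℝ) + 1 / (1 + 1 / (3 + y))) = (4 + y) / (7 + 2 * y) := by
      norm_num; field_simp; ring
    rw [e, lt_div_iff₀ (by linarith)]
    norm_num at *; linarith
  norm_num at *
  linarith

/-- The expansion of both roots of the form of a state. -/
theorem exists_digits (h : MarkovState m d x y) (hd : 1 ≤ d) (hm : 0 < m) (hm4 : m < 4) :
    ∃ a : ℕ → ℕ, a 0 = d ∧ Digits a ∧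
      (∀ n, MarkovState m (a n) (cf (shift (n + 1) a)) (pastCF a y n)) ∧
      x = cf (shift 1 a) := by
  let S := {s : ℕ × ℝ × ℝ // 1 ≤ s.1 ∧ MarkovState m s.1 s.2.1 s.2.2}
  have hstep : ∀ s : S, ∃ t : S, s.1.2.1 = 1 / (t.1.1 + t.1.2.1) ∧
      t.1.2.2 = 1 / (s.1.1 + s.1.2.2) := by
    rintro ⟨⟨d, x, y⟩, h1, h2⟩
    obtain ⟨b, x', hb, hx, h'⟩ := h2.next h1 hm
    exact ⟨⟨⟨b, x', _⟩, hb, h'⟩, hx, rfl⟩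
  choose f hf1 hf2 using hstep
  let s : ℕ → S := fun n => f^[n] ⟨⟨d, x, y⟩, hd, h⟩
  have hs : ∀ n, s (n + 1) = f (s n) := fun n => Function.iterate_succ_apply' f n _
  let a : ℕ → ℕ := fun n => (s n).1.1
  have ha : Digits a := fun n => ⟨(s n).2.1, (s n).2.2.digit_le hm hm4⟩
  have hpast : ∀ n, (s n).1.2.2 = pastCF a y n := by
    intro n
    induction n with
    | zero => rfl
    | succ n ih => rw [hs, hf2, ih]; rfl
  have hX : ∀ n, (s n).1.2.1 = cf (shift (n + 1) a) := by
    intro n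
    have := eq_cf_of_recursion (ha.shift 1) (x := fun n => (s n).1.2.1)
      (fun n => (s n).2.2.1.le) (fun n => (s n).2.2.2.1.le) (fun n => by
        simp only [hs, shift_apply, a, add_comm 1 n]
        exact hf1 (s n)) n
    rw [this, shift_shift, add_comm 1 n]
  refine ⟨a, rfl, ha, fun n => ?_, hX 0⟩
  rw [← hX, ← hpast]
  exact (s n).2.2

end MarkovState

/-! ### From the Markov spectrum to bi-infinite sequences. -/

/-- An equivalent form with leading coefficient close to the infimum and reduced middle
coefficient. -/
theorem exists_reduced_form {a b c : ℝ} (hdisc : b ^ 2 - 4 * a * c = 1)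
    (hI : 0 < quadFormInf a b c) {ε : ℝ} (hε : 0 < ε) :
    ∃ a' b' c' : ℝ, b' ^ 2 - 4 * a' * c' = 1 ∧ |a'| < quadFormInf a b c + ε ∧ |b'| ≤ |a'| ∧
      ∀ p q : ℤ, (p ≠ 0 ∨ q ≠ 0) →
        quadFormInf a b c ≤ |a' * (p : ℝ) ^ 2 + b' * p * q + c' * (q : ℝ) ^ 2| := by
  have hlow : ∀ p q : ℤ, (p ≠ 0 ∨ q ≠ 0) →
      quadFormInf a b c ≤ |a * (p : ℝ) ^ 2 + b * p * q + c * (q : ℝ) ^ 2| := by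
    intro p q hpq
    have hne : ((p, q) : ℤ × ℤ) ≠ 0 := by
      intro h
      rw [Prod.mk_eq_zero] at h
      tauto
    exact ciInf_le (f := fun v : {v : ℤ × ℤ // v ≠ 0} =>
      |a * (v.1.1 : ℝ) ^ 2 + b * (v.1.1 : ℝ) * (v.1.2 : ℝ) + c * (v.1.2 : ℝ) ^ 2|)
      ⟨0, by rintro _ ⟨v, rfl⟩; exact abs_nonneg _⟩ ⟨(p, q), hne⟩
  have : Nonempty {v : ℤ × ℤ // v ≠ 0} := ⟨⟨(1, 0), by simp⟩⟩
  obtain ⟨⟨⟨v1, v2⟩, hv⟩, hvlt⟩ := exists_lt_of_ciInf_lt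
    (show quadFormInf a b c < quadFormInf a b c + ε by linarith)
  simp only at hvlt
  have hv' : v1 ≠ 0 ∨ v2 ≠ 0 := by
    by_contra hc
    push Not at hc
    exact hv (by rw [hc.1, hc.2]; rfl)
  have hg : 0 < Int.gcd v1 v2 := Int.gcd_pos_iff.2 hv'
  obtain ⟨w1, w2, hw, e1, e2⟩ := Int.exists_gcd_one hg
  set g : ℤ := (Int.gcd v1 v2 : ℤ)
  have hg1 : (1 : ℝ) ≤ g := by
    have h0 : (0 : ℤ) < g := Int.natCast_pos.2 hg
    exact_mod_cast Int.add_one_le_iff.2 h0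
  have hw' : w1 ≠ 0 ∨ w2 ≠ 0 := by
    by_contra hc
    push Not at hc
    rw [hc.1, hc.2] at hw; simp at hw
  -- Dividing a vector by its gcd `g` divides the value by g², so a primitive vector does at least
  -- as well.
  have hwlt : |a * (w1 : ℝ) ^ 2 + b * w1 * w2 + c * (w2 : ℝ) ^ 2| < quadFormInf a b c + ε := by
    refine lt_of_le_of_lt ?_ hvlt
    rw [e1, e2]
    push_cast
    have : a * ((w1 : ℝ) * g) ^ 2 + b * (w1 * g) * (w2 * g) + c * (w2 * g) ^ 2 =
      g ^ 2 * (a * (w1 : ℝ) ^ 2 + b * w1 * w2 + c * (w2 : ℝ) ^ 2) := by ring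
    rw [this, abs_mul, abs_of_nonneg (sq_nonneg (g : ℝ))]
    exact le_mul_of_one_le_left (abs_nonneg _) (one_le_pow₀ hg1)
  obtain ⟨u, t, hut⟩ := Int.isCoprime_iff_gcd_eq_one.2 hw
  set a' := a * (w1 : ℝ) ^ 2 + b * w1 * w2 + c * (w2 : ℝ) ^ 2 with ha'
  have ha0 : a' ≠ 0 := by
    intro h0
    have := hlow w1 w2 hw'
    rw [← ha', h0, abs_zero] at this
    linarith
  -- The vectors (w1, w2) and (-t, u) form a basis of determinant 1. Adding `k` times the first to
  -- the second brings the middle coefficient into [-|a'|, |a'|].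
  set b0 := 2 * a * w1 * (-t) + b * (w1 * u + w2 * (-t)) + 2 * c * w2 * u with hb0
  set k : ℤ := round (-b0 / (2 * a')) with hk
  have hutR : (u : ℝ) * w1 + t * w2 = 1 := by exact_mod_cast hut
  refine ⟨a', b0 + 2 * a' * k, a * ((w1 * k - t : ℤ) : ℝ) ^ 2 + b * ((w1 * k - t : ℤ) : ℝ) *
    ((w2 * k + u : ℤ) : ℝ) + c * ((w2 * k + u : ℤ) : ℝ) ^ 2, ?_, hwlt, ?_, ?_⟩
  · have e : (b0 + 2 * a' * k) ^ 2 - 4 * a' * (a * ((w1 * k - t : ℤ) : ℝ) ^ 2 +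
        b * ((w1 * k - t : ℤ) : ℝ) * ((w2 * k + u : ℤ) : ℝ) + c * ((w2 * k + u : ℤ) : ℝ) ^ 2) =
        (b ^ 2 - 4 * a * c) * ((u : ℝ) * w1 + t * w2) ^ 2 := by
      rw [hb0, ha']; push_cast; ring
    rw [e, hdisc, hutR]; norm_num
  · have h1 := abs_sub_round (-b0 / (2 * a'))
    rw [← hk] at h1
    have e : b0 + 2 * a' * k = -(2 * a') * (-b0 / (2 * a') - k) := by field_simp; ring
    rw [e, abs_mul, abs_neg, abs_mul, abs_two]
    nlinarith [abs_nonneg a']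
  · intro p q hpq
    have := hlow (w1 * p + (w1 * k - t) * q) (w2 * p + (w2 * k + u) * q) (by
      by_contra hc
      push Not at hc
      obtain ⟨h1, h2⟩ := hc
      have hq : q = 0 := by linear_combination w1 * h2 - w2 * h1 - q * hut
      have hp : p + k * q = 0 := by linear_combination u * h1 + t * h2 - (p + k * q) * hut
      rw [hq, mul_zero, add_zero] at hp
      tauto)
    refine this.trans_eq ?_
    congr 1
    rw [hb0, ha']; push_cast; ring

/-- A point of the Markov spectrum is attained by a form with minimum at `(1, 0)`. -/
theorem exists_attaining_form {a b c : ℝ} (hdisc : b ^ 2 - 4 * a * c = 1)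
    (hI : 0 < quadFormInf a b c) :
    ∃ b' c' : ℝ, b' ^ 2 - 4 * quadFormInf a b c * c' = 1 ∧
      ∀ p q : ℤ, (p ≠ 0 ∨ q ≠ 0) → quadFormInf a b c ≤
        |quadFormInf a b c * (p : ℝ) ^ 2 + b' * p * q + c' * (q : ℝ) ^ 2| := by
  -- The given form need not attain its infimum. Its reduced equivalents have bounded coefficients,
  -- the last one by the discriminant, and a limit of them attains ±I at (1, 0).
  have hr := fun n : ℕ => exists_reduced_form hdisc hI (ε := 1 / ((n : ℝ) + 1)) (by positivity)
  set I := quadFormInf a b c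
  choose A B C h1 h2 h3 h4 using hr
  have hAlow : ∀ n, I ≤ |A n| := fun n => by simpa using h4 n 1 0 (by norm_num)
  have hAle : ∀ n, |A n| ≤ I + 1 := fun n => by
    have : 1 / ((n : ℝ) + 1) ≤ 1 := by
      rw [div_le_one (by positivity)]; linarith [n.cast_nonneg (α := ℝ)]
    linarith [h2 n]
  set R := ((I + 1) ^ 2 + 1) / (4 * I) with hR
  have hC : ∀ n, |C n| ≤ R := fun n => by
    rw [hR, le_div_iff₀ (by positivity)]
    have e : |4 * A n * C n| = |B n ^ 2 - 1| := by
      congr 1; linarith [h1 n]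
    have e2 : |B n ^ 2 - 1| ≤ (I + 1) ^ 2 + 1 := by
      refine (abs_sub _ _).trans ?_
      rw [abs_of_nonneg (sq_nonneg _), abs_one, ← sq_abs]
      have := (h3 n).trans (hAle n)
      gcongr
    rw [← e, abs_mul, abs_mul, abs_of_pos (by norm_num : (0 : ℝ) < 4)] at e2
    nlinarith [hAlow n, abs_nonneg (C n)]
  have hmem : ∀ n, (A n, B n, C n) ∈
      Set.Icc (-(I + 1)) (I + 1) ×ˢ (Set.Icc (-(I + 1)) (I + 1) ×ˢ Set.Icc (-R) R) :=
    fun n => ⟨abs_le.1 (hAle n), abs_le.1 ((h3 n).trans (hAle n)), abs_le.1 (hC n)⟩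
  obtain ⟨⟨α, β, γ⟩, -, φ, hφ, hlim⟩ :=
    (isCompact_Icc.prod (isCompact_Icc.prod isCompact_Icc)).tendsto_subseq hmem
  have hα : Tendsto (fun n => A (φ n)) atTop (𝓝 α) := (continuous_fst.tendsto _).comp hlim
  have hβ : Tendsto (fun n => B (φ n)) atTop (𝓝 β) :=
    ((continuous_fst.comp continuous_snd).tendsto _).comp hlim
  have hγ : Tendsto (fun n => C (φ n)) atTop (𝓝 γ) :=
    ((continuous_snd.comp continuous_snd).tendsto _).comp hlim
  have hd : β ^ 2 - 4 * α * γ = 1 := by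
    refine tendsto_nhds_unique ((hβ.pow 2).sub ((hα.const_mul 4).mul hγ)) ?_
    simp only [h1]
    exact tendsto_const_nhds
  have hlow : ∀ p q : ℤ, (p ≠ 0 ∨ q ≠ 0) → I ≤
      |α * (p : ℝ) ^ 2 + β * p * q + γ * (q : ℝ) ^ 2| := by
    intro p q hpq
    refine ge_of_tendsto' (((((hα.mul_const ((p : ℝ) ^ 2)).add
      ((hβ.mul_const (p : ℝ)).mul_const (q : ℝ))).add (hγ.mul_const ((q : ℝ) ^ 2)))).abs) ?_
    exact fun n => h4 (φ n) p q hpq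
  have habs : |α| = I := by
    apply le_antisymm
    · have h5 : Tendsto (fun n => I + 1 / (((φ n : ℕ) : ℝ) + 1)) atTop (𝓝 (I + 0)) :=
        (tendsto_one_div_add_atTop_nhds_zero_nat.comp hφ.tendsto_atTop).const_add I
      rw [add_zero] at h5
      exact le_of_tendsto_of_tendsto' hα.abs h5 fun n => (h2 (φ n)).le
    · simpa using hlow 1 0 (by norm_num)
  rcases abs_eq hI.le |>.1 habs with h | h
  · subst h
    exact ⟨β, γ, hd, hlow⟩
  · refine ⟨-β, -γ, ?_, fun p q hpq => ?_⟩
    · rw [← hd, h]; ring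
    · refine (hlow p q hpq).trans_eq ?_
      rw [← abs_neg, h]
      congr 1; ring

/-- The attaining form is I (p - (η + m) q) (p - η q), with roots at distance 1 / I = m. An integral
translation puts the smaller root at -y in (-1, 0). If the larger root were below 3, its integer
part would be 2 and `bounds` would give m < 2 + 4/5 + 4/5 = 3.6 < √13. -/
theorem exists_markovState {m : ℝ} (hm : m ∈ markovSpectrum) (hlow : Real.sqrt 13 < m)
    (hup : m < 3.84) : ∃ x y : ℝ, MarkovState m 3 x y ∧ m = 3 + x + y := by
  obtain ⟨a, b, c, hdisc, hI, hmI⟩ := hm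
  obtain ⟨β, γ, hd, hv⟩ := exists_attaining_form hdisc hI
  set I := quadFormInf a b c
  have h36 : 3.6 < m := by
    refine lt_trans ?_ hlow
    apply Real.lt_sqrt_of_sq_lt; norm_num
  have hm0 : 0 < m := by norm_num at *; linarith
  have hmI' : I * m = 1 := by rw [hmI]; field_simp
  set η := (-β - 1) / (2 * I) with hη
  have hval : ∀ p q : ℤ, (p ≠ 0 ∨ q ≠ 0) → 1 ≤ |((p : ℝ) - (η + m) * q) * (p - η * q)| := by
    intro p q hpq
    have h1 := hv p q hpq
    have e : I * (p : ℝ) ^ 2 + β * p * q + γ * (q : ℝ) ^ 2 =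
        I * (((p : ℝ) - (η + m) * q) * (p - η * q)) := by
      have hγ : γ = (β ^ 2 - 1) / (4 * I) := by field_simp; linarith
      rw [hγ, hη, hmI]; field_simp; ring
    rw [e, abs_mul, abs_of_pos hI] at h1
    exact le_of_mul_le_mul_left (by linarith) hI
  set N : ℤ := ⌊η⌋ + 1 with hN
  set y : ℝ := N - η with hy
  have hy0 : 0 < y := by
    have := Int.lt_floor_add_one η
    rw [hy, hN]; push_cast; linarith
  have hy1 : y < 1 := by
    have h1 := Int.floor_le η
    rcases h1.lt_or_eq with h2 | h2
    · rw [hy, hN]; push_cast; linarith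
    · exfalso
      have := hval ⌊η⌋ 1 (by norm_num)
      rw [h2] at this
      norm_num at this
  have hform : ∀ p q : ℤ, (p ≠ 0 ∨ q ≠ 0) → 1 ≤ |((p : ℝ) - (m - y) * q) * (p + y * q)| := by
    intro p q hpq
    refine (hval (p + N * q) q ?_).trans_eq ?_
    · by_cases hq : q = 0
      · subst hq; simpa using hpq
      · exact Or.inr hq
    · congr 1; rw [hy]; push_cast; ring
  have hint : ∀ k : ℤ, m - y ≠ k := by
    intro k hk
    have := hform k 1 (by norm_num)
    rw [hk] at this
    norm_num at this
  have hstate : ∀ d : ℕ, (d : ℝ) < m - y → m - y < d + 1 → MarkovState m d (m - y - d) y := by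
    intro d h1 h2
    refine ⟨by linarith, by linarith, hy0, hy1, fun p q hpq => ?_⟩
    have e : ((d : ℝ) + (m - y - d) + y) / m = 1 := by field_simp; ring
    have e2 : (d : ℝ) + (m - y - d) = m - y := by ring
    rw [e, e2]
    exact hform p q hpq
  rcases lt_or_ge (m - y) 3 with h3 | h3
  · exfalso
    have h := hstate 2 (by norm_num at *; linarith) (by norm_num at *; linarith)
    have hb := h.bounds (by norm_num) hm0 (by norm_num at *; linarith)
    have hb' := h.mirror.bounds (by norm_num) hm0 (by norm_num at *; linarith)
    norm_num at *
    linarith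
  · have h4 : 3 < m - y := lt_of_le_of_ne h3 (by simpa using (hint 3).symm)
    exact ⟨_, y, hstate 3 (by exact_mod_cast h4) (by norm_num at *; linarith),
      by push_cast; ring⟩

/-- At a 3 with a neighbour 1, the fraction on that side is 1 / (1 + t) with 0 < t < 1, hence above
1/2, against `lt_half`. -/
theorem MarkovState.noThreeOne {m : ℝ} (hm : 0 < m) (hm4 : m < 3.84) {a : ℕ → ℕ} {y : ℝ}
    (ha : Digits a)
    (h : ∀ n, MarkovState m (a n) (cf (shift (n + 1) a)) (pastCF a y n)) : NoThreeOne a := by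
  refine fun n => ⟨fun hn => ?_, fun hn => ?_⟩
  · have h1 := h (n + 1)
    rw [hn.2] at h1
    have h2 := h1.mirror.lt_half hm hm4
    rw [pastCF, hn.1] at h2
    have h3 := h n
    rw [div_lt_div_iff₀ (by have := h3.2.2.1; push_cast; linarith) (by norm_num)] at h2
    have := h3.2.2.2.1
    push_cast at h2; linarith
  · have h1 := h n
    rw [hn.1] at h1
    have h2 := h1.lt_half hm hm4
    have h3 := cf_le (ha.shift (n + 1 + 1))
    have h4 := cf_pos (ha.shift (n + 1 + 1))
    rw [cf_shift_eq ha, hn.2, div_lt_div_iff₀ (by push_cast; linarith) (by norm_num)] at h2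
    push_cast at h2; linarith

/-- A point `m` of the Markov spectrum between `√13` and `3.84` is the height at the centre `3` of a
bi-infinite sequence with letters in `{1, 2, 3}` and without `13` and `31`, all of whose heights
are at most `m`.  The right and left halves, which share the central letter, are `a` and `b`. -/
theorem exists_biinfinite {m : ℝ} (hm : m ∈ markovSpectrum) (hlow : Real.sqrt 13 < m)
    (hup : m < 3.84) : ∃ a b : ℕ → ℕ, (Digits a ∧ NoThreeOne a ∧ a 0 = 3) ∧
      (Digits b ∧ NoThreeOne b ∧ b 0 = 3) ∧ (∀ n, height a (cf (shift 1 b)) n ≤ m) ∧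
      (∀ n, height b (cf (shift 1 a)) n ≤ m) ∧ m = 3 + cf (shift 1 a) + cf (shift 1 b) := by
  obtain ⟨x, y, h, he⟩ := exists_markovState hm hlow hup
  have hm0 : 0 < m := (Real.sqrt_nonneg _).trans_lt hlow
  have hm4 : m < 4 := by norm_num at *; linarith
  obtain ⟨a, ha0, ha, hsa, hx⟩ := h.exists_digits (by norm_num) hm0 hm4
  obtain ⟨b, hb0, hb, hsb, hy⟩ := h.mirror.exists_digits (by norm_num) hm0 hm4
  refine ⟨a, b, ⟨ha, MarkovState.noThreeOne hm0 hup ha hsa, ha0⟩,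
    ⟨hb, MarkovState.noThreeOne hm0 hup hb hsb, hb0⟩, fun n => ?_, fun n => ?_, ?_⟩
  · rw [← hy]; exact (hsa n).sum_le hm0
  · rw [← hx]; exact (hsb n).sum_le hm0
  · rw [← hx, ← hy]; exact he

/-! ### Admissible sequences and the countable set of isolated values. -/

/-- The sequences beginning with `3`, with letters in `{1, 2, 3}` and without `13` and `31`, all of
whose heights are at most `r` when `s` is the value of what precedes. -/
def Admissible (s r : ℝ) (a : ℕ → ℕ) : Prop :=
  Digits a ∧ NoThreeOne a ∧ a 0 = 3 ∧ ∀ n, height a s n ≤ r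

/-- The sequence ends in the full shift on the letters `1` and `2`. -/
def EventuallyLeTwo (a : ℕ → ℕ) : Prop := ∃ N, ∀ n, N ≤ n → a n ≤ 2

/-- Between two different admissible sequences lies an admissible sequence that ends in the full
shift on `1` and `2`. -/
theorem Admissible.exists_between {s r : ℝ} (hs0 : 0 ≤ s) (hs1 : s ≤ 1) (hr : 7 / 2 ≤ r)
    {a b : ℕ → ℕ} (ha : Admissible s r a) (hb : Admissible s r b) {k : ℕ}
    (hab : ∀ i < k, a i = b i) (hlt : a k < b k) :
    ∃ e, Admissible s r e ∧ EventuallyLeTwo e ∧ ∀ i < k, e i = a i := by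
  obtain ⟨had, han, ha3, hah⟩ := ha
  obtain ⟨hbd, hbn, hb3, hbh⟩ := hb
  have hk : 0 < k := by
    rcases Nat.eq_zero_or_pos k with rfl | h
    · omega
    · exact h
  set d := b k - 1 with hd
  have hd1 : 1 ≤ d ∧ d ≤ 2 := by
    have := had k
    have := hbd k
    omega
  have had' : a k ≤ d := by omega
  -- At the first difference the larger letter is lowered by one, and 1, 2, 1, 2, … follows.
  set e : ℕ → ℕ := fun i => if i < k then a i else if i = k then d else oneTwo (i - k - 1) with he
  have e1 : ∀ i < k, e i = a i := fun i hi => by simp [he, hi]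
  have e2 : e k = d := by simp [he]
  have e3 : shift (k + 1) e = oneTwo := by
    funext i
    have h1 : ¬ k + 1 + i < k := by omega
    have h2 : ¬ k + 1 + i = k := by omega
    have h3 : k + 1 + i - k - 1 = i := by omega
    simp only [shift_apply, he, h1, h2, h3, if_false]
  have hle : ∀ n, k ≤ n → e n ≤ 2 := by
    intro n hn
    rcases hn.eq_or_lt with rfl | h
    · rw [e2]; exact hd1.2
    · obtain ⟨i, rfl⟩ := Nat.exists_eq_add_of_le h
      have : e (k + 1 + i) = oneTwo i := congrFun e3 i
      rw [Nat.succ_eq_add_one, this]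
      exact oneTwo_le_two i
  have hed : Digits e := by
    intro n
    rcases lt_trichotomy n k with h | rfl | h
    · rw [e1 n h]; exact had n
    · rw [e2]; omega
    · obtain ⟨i, rfl⟩ := Nat.exists_eq_add_of_le h
      have : e (k + 1 + i) = oneTwo i := congrFun e3 i
      rw [Nat.succ_eq_add_one, this]
      exact digits_oneTwo i
  have hen : NoThreeOne e := by
    intro n
    rcases lt_trichotomy (n + 1) k with h | h | h
    · rw [e1 n (by omega), e1 (n + 1) h]; exact han n
    · rw [e1 n (by omega), h, e2]
      -- A word 31 at the cut means d = 1, so `a k = 1` and `a` itself would contain 31.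
      refine ⟨by omega, fun h31 => ?_⟩
      refine (han n).2 ⟨h31.1, ?_⟩
      rw [h]
      have := (had k).1
      omega
    · have h1 := hle n (by omega)
      have h2 := hle (n + 1) (by omega)
      omega
  have he3 : e 0 = 3 := by rw [e1 0 hk, ha3]
  have hM := cf_le digits_oneTwo
  have hM0 := cf_pos digits_oneTwo
  -- With M = [0; 1, 2, 1, 2, …] maximal, a k plus its tail is at most d + M, which is at most d + 1
  -- = b k.
  have hmid : cf (shift k e) ∈ Set.uIcc (cf (shift k a)) (cf (shift k b)) := by
    rw [cf_shift_eq hed, e2, e3, cf_shift_eq had, cf_shift_eq hbd, Set.mem_uIcc]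
    right
    have hak : (a k : ℝ) ≤ d := by exact_mod_cast had'
    have hbk : (b k : ℝ) = d + 1 := by
      have : b k = d + 1 := by omega
      exact_mod_cast this
    have h1 := cf_le_cf_oneTwo (had.shift (k + 1)) (han.shift (k + 1))
    have h2 := cf_pos (had.shift (k + 1))
    have h3 := cf_pos (hbd.shift (k + 1))
    have h4 := (had.cast k).1
    constructor <;> apply one_div_le_one_div_of_le <;> linarith
  refine ⟨e, ⟨hed, hen, he3, fun n => ?_⟩, ⟨k, hle⟩, e1⟩
  -- Before the cut, the three sequences share letter and past, and the future of `e` lies between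
  -- the other two. From the cut on, letters are at most 2.
  rcases lt_or_ge n k with h | h
  · have hu : cf (shift (n + 1) e) ∈ Set.uIcc (cf (shift (n + 1) a)) (cf (shift (n + 1) b)) := by
      have hidx : n + 1 + (k - (n + 1)) = k := by omega
      refine cf_mem_uIcc (k - (n + 1)) (hed.shift _) (had.shift _) (hbd.shift _)
        (fun i hi => e1 _ (by omega)) (fun i hi => ?_) ?_
      · rw [shift_apply, shift_apply, e1 _ (by omega), hab _ (by omega)]
      · rw [shift_shift, shift_shift, shift_shift, hidx]; exact hmid
    have h1 := hah n
    have h2 := hbh n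
    unfold height at h1 h2 ⊢
    rw [pastCF_congr (b := a) s fun i hi => e1 i (by omega), e1 n h]
    rw [← hab n h, ← pastCF_congr (a := a) s fun i hi => hab i (by omega)] at h2
    rw [Set.mem_uIcc] at hu
    rcases hu with hu | hu <;> linarith [hu.2]
  · exact (height_le_of_le_two hed hen hs0 hs1 (Or.inr he3) (hle n h)).trans hr

/-- The admissible sequences with prefix `u`, provided that no admissible sequence with prefix `u`
ends in the full shift on `1` and `2`. -/
def isolatedSet (s r : ℝ) (u : List ℕ) : Set (ℕ → ℕ) :=
  {a | Admissible s r a ∧ (∀ i < u.length, a i = u.getD i 0) ∧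
    ∀ e, Admissible s r e → (∀ i < u.length, e i = u.getD i 0) → ¬ EventuallyLeTwo e}

theorem subsingleton_isolatedSet {s r : ℝ} (hs0 : 0 ≤ s) (hs1 : s ≤ 1) (hr : 7 / 2 ≤ r)
    (u : List ℕ) : (isolatedSet s r u).Subsingleton := by
  rintro a ⟨ha, hau, hno⟩ b ⟨hb, hbu, -⟩
  by_contra hne
  have hex : ∃ k, a k ≠ b k := Function.ne_iff.1 hne
  set k := Nat.find hex with hk
  have hk1 : a k ≠ b k := Nat.find_spec hex
  have hk2 : ∀ i < k, a i = b i := fun i hi => not_not.1 (Nat.find_min hex hi)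
  have hku : u.length ≤ k := by
    by_contra hc
    exact hk1 ((hau k (not_le.1 hc)).trans (hbu k (not_le.1 hc)).symm)
  rcases lt_or_gt_of_ne hk1 with h | h
  · obtain ⟨e, he, he2, heq⟩ := ha.exists_between hs0 hs1 hr hb hk2 h
    exact hno e he (fun i hi => (heq i (by omega)).trans (hau i hi)) he2
  · obtain ⟨e, he, he2, heq⟩ := hb.exists_between hs0 hs1 hr ha (fun i hi => (hk2 i hi).symm) h
    exact hno e he (fun i hi => (heq i (by omega)).trans (hbu i hi)) he2

/-- The values of the isolated sequences, over all rational parameters.  Since two different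
admissible sequences always have between them one that ends in the full shift on `1` and `2`, each
set of isolated sequences has at most one element, and this set of values is countable. -/
def isolatedValues : Set ℝ :=
  ⋃ (s : ℚ) (r : ℚ) (u : List ℕ) (_ : 0 ≤ (s : ℝ) ∧ (s : ℝ) ≤ 1 ∧ 7 / 2 ≤ (r : ℝ)),
    (fun a => 3 + cf (shift 1 a)) '' isolatedSet s r u

theorem countable_isolatedValues : isolatedValues.Countable := by
  refine Set.countable_iUnion fun s => Set.countable_iUnion fun r => Set.countable_iUnion fun u =>
    Set.countable_iUnion fun h => ?_
  exact ((subsingleton_isolatedSet h.1 h.2.1 h.2.2 u).image _).countable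

/-- Every prefix of `a` can be continued into the full shift on `1` and `2` with heights at most
slightly above `m`. -/
def Connects (s m : ℝ) (a : ℕ → ℕ) : Prop :=
  ∀ k : ℕ, ∀ ε > 0, ∃ e, Admissible s (m + ε) e ∧ EventuallyLeTwo e ∧ ∀ i < k, e i = a i

theorem abs_height_sub_le {a : ℕ → ℕ} (ha : Digits a) {s t : ℝ} (hs : 0 ≤ s) (hs' : s ≤ 1)
    (ht : 0 ≤ t) (ht' : t ≤ 1) (n : ℕ) : |height a s n - height a t n| ≤ |s - t| := by
  have := abs_pastCF_sub_le ha hs hs' ht ht' n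
  unfold height
  rwa [add_sub_add_left_eq_sub]

theorem Admissible.mem_isolatedValues {s m : ℝ} (hs0 : 0 < s) (hs1 : s ≤ 1) (hm : 7 / 2 ≤ m)
    {a : ℕ → ℕ} (ha : Admissible s m a) (hc : ¬ Connects s m a) :
    3 + cf (shift 1 a) ∈ isolatedValues := by
  unfold Connects at hc
  push Not at hc
  obtain ⟨k, ε, hε, hno⟩ := hc
  -- Replacing `s` by `s'` changes heights by at most ε/3. So `a` is admissible for (s', r), and
  -- every sequence admissible for (s', r) is admissible for (s, m + ε).
  obtain ⟨s', h1, h2⟩ := exists_rat_btwn (show max 0 (s - ε / 3) < s by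
    rw [max_lt_iff]; constructor <;> linarith)
  obtain ⟨r, h3, h4⟩ := exists_rat_btwn (show m + ε / 3 < m + 2 * ε / 3 by linarith)
  obtain ⟨h5, h6⟩ := max_lt_iff.1 h1
  have hu : ∀ e : ℕ → ℕ, (∀ i < ((List.range k).map a).length,
      e i = ((List.range k).map a).getD i 0) ↔ ∀ i < k, e i = a i := by
    intro e
    simp only [List.length_map, List.length_range]
    refine forall₂_congr fun i hi => ?_
    rw [List.getD_eq_getElem _ _ (by simpa using hi)]
    simp
  have hd : ∀ e, Digits e → ∀ n, |height e s n - height e s' n| ≤ ε / 3 := fun e he n =>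
    (abs_height_sub_le he hs0.le hs1 h5.le (by linarith) n).trans (by
      rw [abs_le]; constructor <;> linarith)
  simp only [isolatedValues, Set.mem_iUnion]
  refine ⟨s', r, (List.range k).map a, ⟨h5.le, by linarith, by linarith⟩, a,
    ⟨⟨ha.1, ha.2.1, ha.2.2.1, fun n => ?_⟩, (hu a).2 fun _ _ => rfl, fun e he heu he2 => ?_⟩, rfl⟩
  · have := ha.2.2.2 n
    have := abs_le.1 (hd a ha.1 n)
    linarith
  · obtain ⟨i, hi, hne⟩ := hno e ⟨he.1, he.2.1, he.2.2.1, fun n => by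
      have := he.2.2.2 n
      have := abs_le.1 (hd e he.1 n)
      linarith⟩ he2
    exact hne ((hu e).1 heu i hi)

/-! ### Gluing windows into a point of the Lagrange spectrum. -/

/-- Concatenation of the words `w k 0, …, w k (l k - 1)`. -/
theorem exists_concat (w : ℕ → ℕ → ℕ) (l : ℕ → ℕ) (hl : ∀ k, 0 < l k) :
    ∃ c : ℕ → ℕ, (∀ k i, i < l k → c (∑ j ∈ Finset.range k, l j + i) = w k i) ∧
      ∀ n, ∃ k i, i < l k ∧ n = ∑ j ∈ Finset.range k, l j + i := by
  set S : ℕ → ℕ := fun k => ∑ j ∈ Finset.range k, l j with hS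
  have hsucc : ∀ k, S (k + 1) = S k + l k := fun k => Finset.sum_range_succ _ _
  have hmono : Monotone S := monotone_nat_of_le_succ fun k => by rw [hsucc]; omega
  have hge : ∀ k, k ≤ S k := by
    intro k
    induction k with
    | zero => simp
    | succ k ih => rw [hsucc]; have := hl k; omega
  have hex : ∀ n, ∃ k, n < S (k + 1) := fun n => ⟨n, by have := hge (n + 1); omega⟩
  refine ⟨fun n => w (Nat.find (hex n)) (n - S (Nat.find (hex n))), fun k i hi => ?_, fun n => ?_⟩
  · have : Nat.find (hex (S k + i)) = k := by
      rw [Nat.find_eq_iff]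
      refine ⟨by rw [hsucc]; omega, fun j hj => ?_⟩
      have := hmono (show j + 1 ≤ k by omega)
      omega
    change w (Nat.find (hex (S k + i))) (S k + i - S (Nat.find (hex (S k + i)))) = _
    rw [this, Nat.add_sub_cancel_left]
  · have h1 := Nat.find_spec (hex n)
    set k := Nat.find (hex n) with hk
    have h2 : S k ≤ n := by
      rcases Nat.eq_zero_or_pos k with h0 | h0
      · rw [h0]; simp [hS]
      · have := Nat.find_min (hex n) (show k - 1 < Nat.find (hex n) by omega)
        rw [Nat.sub_add_cancel h0] at this
        omega
    rw [hsucc] at h1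
    exact ⟨k, n - S k, by omega, (Nat.add_sub_of_le h2).symm⟩

/-- If the window of radius `N` of `c` around position `p` has right half `A` and left half `B`, its
heights are close to those of the bi-infinite sequence with halves `A` and `b`, where `b` and `B`
have a common prefix. -/
theorem height_right_approx {c A B b : ℕ → ℕ} (hc : Digits c) (hA : Digits A) (hb : Digits b)
    {p N k j : ℕ} (hN : N ≤ p) (hcA : ∀ i ≤ N, c (p + i) = A i) (hcB : ∀ i ≤ N, c (p - i) = B i)
    (hBb : ∀ i < k + 1, B i = b i) (hj : j + k < N) :
    |height c 0 (p + j) - height A (cf (shift 1 b)) j| ≤ 2 * (16 / 25) ^ k := by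
  have h1 : |cf (shift (p + j + 1) c) - cf (shift (j + 1) A)| ≤ (16 / 25) ^ k :=
    abs_cf_sub_le k (hc.shift _) (hA.shift _) fun i hi => by
      rw [shift_apply, shift_apply, ← hcA _ (by omega)]
      congr 1; omega
  have h2 : |pastCF c 0 p - cf (shift 1 b)| ≤ (16 / 25) ^ k := by
    have hp : p - k + k = p := by omega
    have := abs_pastCF_sub_cf_le (s := 0) hc (hb.shift 1) (n := p - k) k (fun i hi => by
      rw [shift_apply, ← hBb _ (by omega), ← hcB _ (by omega), hp]
      congr 1; omega) (quarter_le_pastCF hc le_rfl zero_le_one (by omega))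
      (pastCF_mem hc le_rfl zero_le_one _).2
    rwa [hp] at this
  have h3 : |pastCF c 0 (p + j) - pastCF A (cf (shift 1 b)) j| ≤ (16 / 25) ^ k := by
    have e : pastCF (shift p c) (pastCF c 0 p) j = pastCF A (pastCF c 0 p) j :=
      pastCF_congr _ fun i hi => hcA i (by omega)
    rw [pastCF_add, e]
    have hm := pastCF_mem hc (le_refl (0 : ℝ)) zero_le_one p
    have hm' := cf_mem_aux (hb.shift 1)
    exact (abs_pastCF_sub_le hA hm.1 hm.2 (by linarith) hm'.2 j).trans h2
  rw [abs_le] at *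
  unfold height
  rw [hcA j (by omega)]
  constructor <;> linarith

/-- The statement of `height_right_approx` for the left half of the window. -/
theorem height_left_approx {c A B a : ℕ → ℕ} (hc : Digits c) (hB : Digits B) (ha : Digits a)
    {p N k j : ℕ} (hN : N ≤ p) (hcA : ∀ i ≤ N, c (p + i) = A i) (hcB : ∀ i ≤ N, c (p - i) = B i)
    (hAa : ∀ i < k + 1, A i = a i) (hj : j + k < N) :
    |height c 0 (p - j) - height B (cf (shift 1 a)) j| ≤ 2 * (16 / 25) ^ k := by
  have h1 : |pastCF c 0 (p - j) - cf (shift (j + 1) B)| ≤ (16 / 25) ^ k := by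
    have hp : p - j - k + k = p - j := by omega
    have := abs_pastCF_sub_cf_le (s := 0) hc (hB.shift (j + 1)) (n := p - j - k) k (fun i hi => by
      rw [shift_apply, ← hcB _ (by omega), hp]
      congr 1; omega) (quarter_le_pastCF hc le_rfl zero_le_one (by omega))
      (pastCF_mem hc le_rfl zero_le_one _).2
    rwa [hp] at this
  have h2 : |cf (shift (p + 1) c) - cf (shift 1 a)| ≤ (16 / 25) ^ k :=
    abs_cf_sub_le k (hc.shift _) (ha.shift _) fun i hi => by
      rw [shift_apply, shift_apply, ← hAa _ (by omega), ← hcA _ (by omega), add_assoc]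
  have h3 : |cf (shift (p - j + 1) c) - pastCF B (cf (shift 1 a)) j| ≤ (16 / 25) ^ k := by
    have hp : p - j + 1 = p + 1 - j := by omega
    rw [hp, cf_shift_eq_pastCF hc (by omega) fun i hi => (hcB i (by omega)).symm]
    have hm := cf_mem_aux (hc.shift (p + 1))
    have hm' := cf_mem_aux (ha.shift 1)
    exact (abs_pastCF_sub_le hB (by linarith) hm.2 (by linarith) hm'.2 j).trans h2
  rw [abs_le] at *
  unfold height
  rw [hcB j (by omega)]
  constructor <;> linarith

/-- If both halves of a bi-infinite sequence with heights at most `m`, attained at the centre, can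
be connected to the full shift on `1` and `2`, then `m` belongs to the Lagrange spectrum. -/
theorem mem_lagrangeSpectrum_of_connects {m : ℝ} (hm : 7 / 2 ≤ m) {a b : ℕ → ℕ} (ha : Digits a)
    (hb : Digits b) (hca : Connects (cf (shift 1 b)) m a) (hcb : Connects (cf (shift 1 a)) m b)
    (hval : m = 3 + cf (shift 1 a) + cf (shift 1 b)) : m ∈ lagrangeSpectrum := by
  have hA := fun k : ℕ => hca (k + 1) (1 / ((k : ℝ) + 1)) (by positivity)
  have hB := fun k : ℕ => hcb (k + 1) (1 / ((k : ℝ) + 1)) (by positivity)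
  choose A hA1 hA2 hA3 using hA
  choose B hB1 hB2 hB3 using hB
  choose NA hNA using hA2
  choose NB hNB using hB2
  -- Each window ends in letters at most 2 on both sides, so junctions create no 13 or 31. The
  -- summand `k` leaves at least `k` letters of the window beyond every 3, enough to approximate the
  -- height there.
  let N : ℕ → ℕ := fun k => NA k + NB k + k
  -- The k-th window reads `B k` backwards and then `A k`; they share the central 3, at position S k
  -- + N k.
  obtain ⟨c, hc1, hc2⟩ := exists_concat
    (fun k i => if i < N k then B k (N k - i) else A k (i - N k)) (fun k => 2 * N k + 1)
    (fun k => by omega)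
  set S : ℕ → ℕ := fun k => ∑ j ∈ Finset.range k, (2 * N j + 1) with hS
  have hsucc : ∀ k, S (k + 1) = S k + (2 * N k + 1) := fun k => Finset.sum_range_succ _ _
  have hmono : Monotone S := monotone_nat_of_le_succ fun k => by rw [hsucc]; omega
  have hge : ∀ k, k ≤ S k := by
    intro k
    induction k with
    | zero => simp
    | succ k ih => rw [hsucc]; omega
  have hcA : ∀ k, ∀ i ≤ N k, c (S k + N k + i) = A k i := by
    intro k i hi
    rw [add_assoc, hc1 k (N k + i) (by omega), if_neg (by omega), Nat.add_sub_cancel_left]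
  have hcB : ∀ k, ∀ i ≤ N k, c (S k + N k - i) = B k i := by
    intro k i hi
    rcases Nat.eq_zero_or_pos i with rfl | h0
    · have := hcA k 0 (by omega)
      rw [add_zero] at this
      rw [Nat.sub_zero, this, (hA1 k).2.2.1, (hB1 k).2.2.1]
    · rw [show S k + N k - i = S k + (N k - i) by omega, hc1 k (N k - i) (by omega),
        if_pos (by omega)]
      congr 1; omega
  have hdec : ∀ n, ∃ k i, i ≤ N k ∧ (n = S k + N k + i ∨ n = S k + N k - i) := by
    intro n
    obtain ⟨k, i, hi, rfl⟩ := hc2 n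
    rcases le_or_gt (N k) i with h | h
    · exact ⟨k, i - N k, by omega, Or.inl (by simp only [hS]; omega)⟩
    · exact ⟨k, N k - i, by omega, Or.inr (by simp only [hS]; omega)⟩
  have hcd : Digits c := by
    intro n
    obtain ⟨k, i, hi, rfl | rfl⟩ := hdec n
    · rw [hcA k i hi]; exact (hA1 k).1 i
    · rw [hcB k i hi]; exact (hB1 k).1 i
  have hcn : NoThreeOne c := by
    intro n
    obtain ⟨k, i, hi, rfl | rfl⟩ := hdec n
    · rcases hi.lt_or_eq with h | rfl
      · rw [hcA k i hi, add_assoc, hcA k (i + 1) h]; exact (hA1 k).2.1 i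
      · have h1 : c (S k + N k + N k) ≤ 2 := by
          rw [hcA k _ le_rfl]; exact hNA k _ (by simp only [N]; omega)
        have h2 : c (S k + N k + N k + 1) ≤ 2 := by
          have e : S k + N k + N k + 1 = S (k + 1) + N (k + 1) - N (k + 1) := by
            rw [hsucc]; omega
          rw [e, hcB (k + 1) _ le_rfl]; exact hNB _ _ (by simp only [N]; omega)
        omega
    · rcases Nat.eq_zero_or_pos i with rfl | h0
      · have h1 : 0 < N k := by
          have : 0 < NA k := by
            by_contra h
            have := hNA k 0 (by omega)
            rw [(hA1 k).2.2.1] at this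
            omega
          simp only [N]; omega
        have h2 := hcA k 0 (by omega)
        rw [add_zero] at h2
        rw [Nat.sub_zero, h2, hcA k 1 h1]
        exact (hA1 k).2.1 0
      · have e : S k + N k - i + 1 = S k + N k - (i - 1) := by omega
        rw [e, hcB k i hi, hcB k (i - 1) (by omega)]
        have := (hB1 k).2.1 (i - 1)
        rw [Nat.sub_add_cancel h0] at this
        exact ⟨fun h => this.2 h.symm, fun h => this.1 h.symm⟩
  have hright : ∀ k j, j < NA k → |height c 0 (S k + N k + j) - height (A k) (cf (shift 1 b)) j| ≤
      2 * (16 / 25) ^ k := fun k j hj =>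
    height_right_approx hcd (hA1 k).1 hb (Nat.le_add_left _ _) (hcA k) (hcB k) (hB3 k)
      (by simp only [N]; omega)
  have hleft : ∀ k j, j < NB k → |height c 0 (S k + N k - j) - height (B k) (cf (shift 1 a)) j| ≤
      2 * (16 / 25) ^ k := fun k j hj =>
    height_left_approx hcd (hB1 k).1 ha (Nat.le_add_left _ _) (hcA k) (hcB k) (hA3 k)
      (by simp only [N]; omega)
  have hlim : Tendsto (fun k : ℕ => 1 / ((k : ℝ) + 1) + 2 * (16 / 25) ^ k) atTop (𝓝 0) := by
    have h1 := tendsto_one_div_add_atTop_nhds_zero_nat (𝕜 := ℝ)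
    have h2 := (tendsto_pow_atTop_nhds_zero_of_lt_one (r := (16 / 25 : ℝ)) (by norm_num)
      (by norm_num)).const_mul 2
    simpa using h1.add h2
  refine mem_lagrangeSpectrum hcd (by linarith) (fun δ hδ => ?_) (fun δ hδ => ?_)
  · obtain ⟨K, hK⟩ := eventually_atTop.1 (hlim.eventually (ge_mem_nhds hδ))
    -- Positions from `S K` on lie in windows of index at least `K`; the extra 2 is what
    -- `height_le_of_le_two` needs. A letter 3 lies in the non-trivial part of its window, where the
    -- height is at most m + 1 / (k + 1) + 2 (16/25)^k.
    refine eventually_atTop.2 ⟨S K + 2, fun n hn => ?_⟩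
    rcases Nat.lt_or_ge 2 (c n) with h3 | h3
    · obtain ⟨k, i, hi, hni⟩ := hdec n
      have hkK : K ≤ k := by
        by_contra hlt
        have h1 := hmono (show k + 1 ≤ K by omega)
        rw [hsucc] at h1
        omega
      have hδk := hK k hkK
      rcases hni with rfl | rfl
      · rw [hcA k i hi] at h3
        have hiA : i < NA k := by
          by_contra h
          have := hNA k i (by omega)
          omega
        have h4 := (abs_le.1 (hright k i hiA)).2
        have h5 := (hA1 k).2.2.2 i
        linarith
      · rw [hcB k i hi] at h3
        have hiB : i < NB k := by
          by_contra h
          have := hNB k i (by omega)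
          omega
        have h4 := (abs_le.1 (hleft k i hiB)).2
        have h5 := (hB1 k).2.2.2 i
        linarith
    · have := height_le_of_le_two hcd hcn (le_refl (0 : ℝ)) zero_le_one
        (Or.inl (by omega : 2 ≤ n)) h3
      linarith
  · obtain ⟨K, hK⟩ := eventually_atTop.1 (hlim.eventually (ge_mem_nhds (half_pos hδ)))
    -- At the centres of the windows the heights approach m.
    refine frequently_atTop.2 fun n => ⟨S (max n K) + N (max n K), ?_, ?_⟩
    · have := hge (max n K)
      have := le_max_left n K
      omega
    · set k := max n K
      have hδk := hK k (le_max_right n K)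
      have hpos : (0 : ℝ) < 1 / ((k : ℝ) + 1) := by positivity
      have h0 : 0 < NA k := by
        by_contra h
        have := hNA k 0 (by omega)
        rw [(hA1 k).2.2.1] at this
        omega
      have h1 := (abs_le.1 (hright k 0 h0)).1
      have h2 : |cf (shift 1 (A k)) - cf (shift 1 a)| ≤ (16 / 25) ^ k :=
        abs_cf_sub_le k ((hA1 k).1.shift 1) (ha.shift 1) fun i hi => hA3 k _ (by omega)
      have h3 : height (A k) (cf (shift 1 b)) 0 = 3 + cf (shift 1 (A k)) + cf (shift 1 b) := by
        rw [height, (hA1 k).2.2.1]; norm_num [pastCF]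
      rw [h3, add_zero] at h1
      have h4 := (abs_le.1 h2).1
      linarith

/-! ### Conclusion. -/

/-- The set `K` can be taken countable: one half of a sequence attaining a point of `M \ L` cannot be
connected to the full shift on `1` and `2`, hence is isolated. -/
theorem propositionp :
    ∃ K : Set ℝ, dimH K < ENNReal.ofReal 0.281266 ∧
      (markovSpectrum \ lagrangeSpectrum) ∩ Set.Ioo (Real.sqrt 13) 3.84 ⊆
        XSet 3 {[1, 3], [3, 1]} + K := by
  refine ⟨isolatedValues, ?_, ?_⟩
  · rw [dimH_countable countable_isolatedValues]
    exact ENNReal.ofReal_pos.2 (by norm_num)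
  · rintro m ⟨⟨hM, hL⟩, hlow, hup⟩
    obtain ⟨a, b, ⟨ha, han, ha3⟩, ⟨hb, hbn, hb3⟩, hha, hhb, hval⟩ := exists_biinfinite hM hlow hup
    have hm : 7 / 2 ≤ m := by
      refine le_trans ?_ hlow.le
      apply Real.le_sqrt_of_sq_le; norm_num
    have hmem : ∀ c, Digits c → 0 < cf (shift 1 c) ∧ cf (shift 1 c) ≤ 1 := fun c hc =>
      ⟨cf_pos (hc.shift 1), (cf_mem_aux (hc.shift 1)).2⟩
    -- The half that fails to connect supplies, together with the central 3, the summand in K; the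
    -- other half supplies the one in X_3({13, 31}).
    by_cases hca : Connects (cf (shift 1 b)) m a
    · have hcb : ¬ Connects (cf (shift 1 a)) m b := fun hcb =>
        hL (mem_lagrangeSpectrum_of_connects hm ha hb hca hcb hval)
      refine ⟨cf (shift 1 a), cf_mem_XSet (ha.shift 1) (han.shift 1), 3 + cf (shift 1 b),
        Admissible.mem_isolatedValues (hmem a ha).1 (hmem a ha).2 hm ⟨hb, hbn, hb3, hhb⟩ hcb, ?_⟩
      simp only
      linarith
    · refine ⟨cf (shift 1 b), cf_mem_XSet (hb.shift 1) (hbn.shift 1), 3 + cf (shift 1 a),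
        Admissible.mem_isolatedValues (hmem b hb).1 (hmem b hb).2 hm ⟨ha, han, ha3, hha⟩ hca, ?_⟩
      simp only
      linarith

end
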